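/- Let $\mathbb T=\{z\in\mathbb C:|z|=1\}$ and $A_r=\{z\in\mathbb C: r<|z|<r^{-1}\}$ for $0<r<1$. Let $\tau:\mathbb T\to\mathbb T$ be an analytic expanding circle map, that is, $\tau$ extends holomorphically to some annulus $A_\rho$ with $0<\rho<1$, and $\min_{z\in\mathbb T}|\tau'(z)|>1$. Put $\tau'_{\max}=\max_{z\in\mathbb T}|\tau'(z)|$. For $r\in(0,1)$ let $H^2(A_r^c)$ be the Hilbert space obtained by completing the space of Laurent polynomials with respect to the norm $\|f\|=\bigl(\sum_{n\in\mathbb Z}|c_n(f)|^2r^{2|n|}\bigr)^{1/2}$, where $c_n(f)=\frac1{2\pi}\int_0^{2\pi}f(e^{it})e^{-int}\,dt$; a bounded function $f$ on $\mathbb T$ is identified with the element $\sum_n c_n(f)z^n$ of $H^2(A_r^c)$. The Koopman operator $C_\tau$ on $H^2(A_r^c)$ is the continuous extension, if there is one, of $f\mapsto f\circ\tau$ from the Laurent polynomials. For $\alpha\in\mathbb R$ and $m,n\in\mathbb N=\{1,2,\dots\}$ consider the observables $\psi_k(z)=z^k$, $|k|\le n-1$, and the points $z^{(j)}=e^{2\pi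 i j/m+i\alpha}$, $0\le j\le m-1$. The associated $(2n-1)\times(2n-1)$ EDMD matrix is $M=GH^{-1}$, where $$G_{k,l}=\frac1m\sum_{j=0}^{m-1}\psi_k(\tau(z^{(j)}))\overline{\psi_l(z^{(j)})},\qquad H_{k,l}=\frac1m\sum_{j=0}^{m-1}\psi_k(z^{(j)})\overline{\psi_l(z^{(j)})}.$$ Theorem. Let $\delta>1+\tau'_{\max}$. Then there is $r\in(0,1)$ such that $C_\tau$ is a well-defined Hilbert–Schmidt operator on $H^2(A_r^c)$ and such that the following holds for every $\alpha\in\mathbb R$ and every choice of $m=m(n)\in\mathbb N$ with $m(n)\ge\delta n$ for all $n\in\mathbb N$. Let $M_n$ denote the EDMD matrix with parameters $\alpha$, $m(n)$, $n$. (a) If $\lambda_n\in\operatorname{spec}(M_n)$ for all $n$ and $(\lambda_n)$ converges, then its limit belongs to $\operatorname{spec}(C_\tau)$. (b) For every $\lambda\in\operatorname{spec}(C_\tau)$ there are $\lambda_n\in\operatorname{spec}(M_n)$ with $\lambda_n\to\lambda$ and $|\lambda-\lambda_n|=O(e^{-an})$ as $n\to\infty$, for some $a>0$. (c) Let $\lambda\in\operatorname{spec}(C_\tau)$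 be non-zero. Then $\lambda$ is an eigenvalue of $C_\tau$ and an isolated point of $\operatorname{spec}(C_\tau)$; let $\mathcal P=\frac1{2\pi i}\oint_{|\zeta-\lambda|=\varepsilon}(\zeta-C_\tau)^{-1}\,d\zeta$ ($\varepsilon>0$ small) be its spectral projection. There is $b>0$ such that, whenever $\lambda_n\in\operatorname{spec}(M_n)$, $\lambda_n\to\lambda$, and $\xi_n=(\xi_{n,k})_{|k|<n}\in\mathbb C^{2n-1}$ is a generalised eigenvector of the transpose $M_n^T$ for the eigenvalue $\lambda_n$ with $\sum_{|k|<n}|\xi_{n,k}|^2r^{2|k|}=1$ for all $n$, the Laurent polynomials $h_n(z)=\sum_{|k|<n}\xi_{n,k}z^k$ satisfy $$\|\mathcal Ph_n-h_n\|_{H^2(A_r^c)}=O(e^{-bn})\quad\text{as }n\to\infty.$$ -/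

import Mathlib

open Filter Topology

noncomputable section

/-! ### Analytic expanding circle maps -/

/-- The open annulus `A_r = {z : r < |z| < 1/r}`, which contains the unit circle if `0 < r < 1`. -/
def annulus (r : ℝ) : Set ℂ := {z | r < ‖z‖ ∧ ‖z‖ < r⁻¹}

/-- `τ` maps the unit circle to itself, is holomorphic on some annulus `A_r` with `0 < r < 1`,
and `|τ'| > 1` on the unit circle.  A circle map and its (unique) analytic extension to the annulus
are written as one function `τ : ℂ → ℂ`; its values off that annulus play no role. -/
structure IsAnalyticExpandingCircleMap (τ : ℂ → ℂ) : Prop where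
  holomorphic : ∃ r : ℝ, 0 < r ∧ r < 1 ∧ DifferentiableOn ℂ τ (annulus r)
  mapsTo : ∀ z : ℂ, ‖z‖ = 1 → ‖τ z‖ = 1
  expanding : ∀ z : ℂ, ‖z‖ = 1 → 1 < ‖deriv τ z‖

/-- The maximal derivative `max_{|z| = 1} |τ'(z)|`. -/
def maxDeriv (τ : ℂ → ℂ) : ℝ := ⨆ z : Circle, ‖deriv τ (z : ℂ)‖

/-! ### The space `H²(A_r^c)` -/

/-- The space `L` of Laurent polynomials, to be equipped with the norm with index `r`. -/
def LaurentSpace (_r : ℝ) : Type := LaurentPolynomial ℂ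

namespace LaurentSpace

variable {r : ℝ}

instance : AddCommGroup (LaurentSpace r) := inferInstanceAs (AddCommGroup (LaurentPolynomial ℂ))

instance : Module ℂ (LaurentSpace r) := inferInstanceAs (Module ℂ (LaurentPolynomial ℂ))

/-- The coefficient of `z ^ n`, which is the `n`-th Fourier coefficient `c_n(p)`. -/
def coeff (p : LaurentSpace r) : ℤ →₀ ℂ := AddMonoidAlgebra.coeff (R := ℂ) (M := ℤ) p

/-- The Laurent monomial `z ^ n`. -/
def monomial (r : ℝ) (n : ℤ) : LaurentSpace r := (LaurentPolynomial.T n : LaurentPolynomial ℂ)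

/-- The value `∑ c_n z ^ n` of a Laurent polynomial at `z` (used for `z ≠ 0`). -/
def eval (p : LaurentSpace r) (z : ℂ) : ℂ := p.coeff.sum fun n c => c * z ^ n

/-- The scalar product `∑ conj (c_n(p)) c_n(q) r ^ (2 |n|)`, linear in the second argument. -/
def innerProd (p q : LaurentSpace r) : ℂ :=
  q.coeff.sum fun n c => (starRingEnd ℂ) (p.coeff n) * c * ((r ^ (2 * n.natAbs) : ℝ) : ℂ)

theorem coeff_add (p q : LaurentSpace r) : (p + q).coeff = p.coeff + q.coeff := rfl

theorem coeff_smul (a : ℂ) (p : LaurentSpace r) : (a • p).coeff = a • p.coeff := rfl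

theorem innerProd_eq_sum (p q : LaurentSpace r) {s : Finset ℤ}
    (h : p.coeff.support ⊆ s ∨ q.coeff.support ⊆ s) :
    innerProd p q =
      ∑ n ∈ s, (starRingEnd ℂ) (p.coeff n) * q.coeff n * ((r ^ (2 * n.natAbs) : ℝ) : ℂ) := by
  have key : ∀ t : Finset ℤ, q.coeff.support ⊆ t → innerProd p q =
      ∑ n ∈ t, (starRingEnd ℂ) (p.coeff n) * q.coeff n * ((r ^ (2 * n.natAbs) : ℝ) : ℂ) := by
    intro t ht
    exact Finsupp.sum_of_support_subset _ ht _ (by simp)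
  rcases h with h | h
  · rw [key (s ∪ q.coeff.support) Finset.subset_union_right]
    symm
    refine Finset.sum_subset Finset.subset_union_left fun n _ hn => ?_
    have : p.coeff n = 0 := Finsupp.notMem_support_iff.mp fun h' => hn (h h')
    simp [this]
  · exact key s h

/-- The positive semidefinite scalar product of `LaurentSpace r` (definite if `r ≠ 0`). -/
@[reducible] def core (r : ℝ) : PreInnerProductSpace.Core ℂ (LaurentSpace r) where
  inner := innerProd
  conj_inner_symm p q := by
    rw [innerProd_eq_sum q p (Or.inr subset_rfl), innerProd_eq_sum p q (Or.inl subset_rfl), map_sum]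
    refine Finset.sum_congr rfl fun n _ => ?_
    simp only [map_mul, Complex.conj_conj, Complex.conj_ofReal]
    ring
  re_inner_nonneg p := by
    rw [innerProd_eq_sum p p (Or.inl subset_rfl), map_sum]
    refine Finset.sum_nonneg fun n _ => ?_
    rw [← Complex.normSq_eq_conj_mul_self, ← Complex.ofReal_mul]
    exact mul_nonneg (Complex.normSq_nonneg _) (by rw [pow_mul]; positivity)
  add_left p q t := by
    rw [innerProd_eq_sum p t (Or.inr subset_rfl), innerProd_eq_sum q t (Or.inr subset_rfl),
      innerProd_eq_sum (p + q) t (Or.inr subset_rfl), ← Finset.sum_add_distrib]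
    refine Finset.sum_congr rfl fun n _ => ?_
    simp only [coeff_add, Finsupp.add_apply, map_add]
    ring
  smul_left p q a := by
    rw [innerProd_eq_sum p q (Or.inr subset_rfl), innerProd_eq_sum (a • p) q (Or.inr subset_rfl),
      Finset.mul_sum]
    refine Finset.sum_congr rfl fun n _ => ?_
    simp only [coeff_smul, Finsupp.smul_apply, smul_eq_mul, map_mul]
    ring

instance : SeminormedAddCommGroup (LaurentSpace r) :=
  @InnerProductSpace.Core.toSeminormedAddCommGroup ℂ (LaurentSpace r) _ _ _ (core r)

instance : InnerProductSpace ℂ (LaurentSpace r) := InnerProductSpace.ofCore (core r)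

/-- The norm of a Laurent polynomial is `√(∑ |c_n|² r ^ (2 |n|))`. -/
theorem norm_eq (p : LaurentSpace r) :
    ‖p‖ = √(p.coeff.sum fun n c => ‖c‖ ^ 2 * r ^ (2 * n.natAbs)) := by
  have h : ‖p‖ ^ 2 = RCLike.re (inner ℂ p p) := (inner_self_eq_norm_sq p).symm
  have h2 : inner ℂ p p = innerProd p p := rfl
  rw [h2, innerProd_eq_sum p p (Or.inl subset_rfl), map_sum] at h
  rw [← Real.sqrt_sq (norm_nonneg p), h, Finsupp.sum]
  congr 1
  refine Finset.sum_congr rfl fun n _ => ?_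
  rw [← Complex.normSq_eq_conj_mul_self, ← Complex.ofReal_mul, Complex.normSq_eq_norm_sq]
  rfl

end LaurentSpace

/-- The Hilbert space `H²(A_r^c)`: the completion of the space of Laurent polynomials with respect
to the norm `√(∑ |c_n|² r ^ (2 |n|))`. -/
abbrev HardyCompl (r : ℝ) : Type := UniformSpace.Completion (LaurentSpace r)

/-- The element `z ^ n` of `H²(A_r^c)`. -/
def hardyMonomial (r : ℝ) (n : ℤ) : HardyCompl r := (LaurentSpace.monomial r n : HardyCompl r)

/-- The Fourier coefficient `c_n(f) = (2π)⁻¹ ∫_0^{2π} f(e^{it}) e^{-int} dt`. -/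
def circleFourierCoeff (f : ℂ → ℂ) (n : ℤ) : ℂ :=
  (2 * Real.pi : ℂ)⁻¹ * ∫ t in (0 : ℝ)..(2 * Real.pi),
    f (Complex.exp (t * Complex.I)) * Complex.exp (-(n * t * Complex.I))

/-- `F` is the element of `H²(A_r^c)` given by the function `f` on the unit circle: the Fourier
series of `f` converges to `F` in `H²(A_r^c)`. -/
def RepresentsFunction {r : ℝ} (F : HardyCompl r) (f : ℂ → ℂ) : Prop :=
  HasSum (fun n : ℤ => circleFourierCoeff f n • hardyMonomial r n) F

/-- The bounded operator `C` on `H²(A_r^c)` is the Koopman operator `f ↦ f ∘ τ`, that is, it is the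
continuous extension of `p ↦ p ∘ τ` from the dense subspace of Laurent polynomials. There is at
most one such operator. -/
def IsKoopmanOperator (τ : ℂ → ℂ) {r : ℝ} (C : HardyCompl r →L[ℂ] HardyCompl r) : Prop :=
  ∀ p : LaurentSpace r, RepresentsFunction (C (p : HardyCompl r)) fun z => p.eval (τ z)

/-! ### Operators on Hilbert spaces -/

/-- `T` is Hilbert–Schmidt: `∑ ‖T b_i‖² < ∞` for an orthonormal basis `b` (the sum does not depend
on the basis). -/
def IsHilbertSchmidt {H : Type*} [NormedAddCommGroup H] [InnerProductSpace ℂ H]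
    (T : H →L[ℂ] H) : Prop :=
  ∃ (S : Set H) (b : HilbertBasis S ℂ H), Summable fun i => ‖T (b i)‖ ^ 2

/-- `P` is the spectral (Riesz) projection of `T` for an isolated point `μ` of the spectrum:
`P = (2πi)⁻¹ ∮_{|ζ - μ| = ε} (ζ - T)⁻¹ dζ`, where the closed disc with radius `ε > 0` about `μ`
contains no other spectral point. -/
def IsSpectralProjection {H : Type*} [NormedAddCommGroup H] [NormedSpace ℂ H]
    (T : H →L[ℂ] H) (μ : ℂ) (P : H →L[ℂ] H) : Prop :=
  ∃ ε : ℝ, 0 < ε ∧ Metric.closedBall μ ε ∩ spectrum ℂ T = {μ} ∧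
    P = (2 * Real.pi * Complex.I : ℂ)⁻¹ • ∮ ζ in C(μ, ε), resolvent T ζ

/-! ### Extended dynamic mode decomposition -/

/-- The matrix `G_{k,l} = m⁻¹ ∑_j ψ_k(τ(z_j)) conj (ψ_l(z_j))`. -/
def edmdG {ι : Type*} (τ : ℂ → ℂ) (ψ : ι → ℂ → ℂ) {m : ℕ} (z : Fin m → ℂ) : Matrix ι ι ℂ :=
  fun k l => (m : ℂ)⁻¹ * ∑ j, ψ k (τ (z j)) * (starRingEnd ℂ) (ψ l (z j))

/-- The matrix `H_{k,l} = m⁻¹ ∑_j ψ_k(z_j) conj (ψ_l(z_j))`. -/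
def edmdH {ι : Type*} (ψ : ι → ℂ → ℂ) {m : ℕ} (z : Fin m → ℂ) : Matrix ι ι ℂ :=
  fun k l => (m : ℂ)⁻¹ * ∑ j, ψ k (z j) * (starRingEnd ℂ) (ψ l (z j))

/-- The EDMD matrix `M = G H⁻¹`. -/
def edmdM {ι : Type*} [Fintype ι] [DecidableEq ι] (τ : ℂ → ℂ) (ψ : ι → ℂ → ℂ) {m : ℕ}
    (z : Fin m → ℂ) : Matrix ι ι ℂ :=
  edmdG τ ψ z * (edmdH ψ z)⁻¹

/-- The `2n - 1` indices `-(n-1), …, n-1` (for `n ≥ 1`). -/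
abbrev LaurentIndex (n : ℕ) : Type := Finset.Ioo (-(n : ℤ)) (n : ℤ)

/-- The observables `ψ_l(z) = z ^ l`, `|l| < n`. -/
def laurentObservable (n : ℕ) (l : LaurentIndex n) (z : ℂ) : ℂ := z ^ (l : ℤ)

/-- The phase space points `z_j = e^{2πij/m + iα}`, `0 ≤ j < m`. -/
def equispacedPoint (α : ℝ) (m : ℕ) (j : Fin m) : ℂ :=
  Complex.exp (2 * Real.pi * Complex.I * (j : ℕ) / m + Complex.I * α)

/-- The `(2n-1) × (2n-1)` EDMD matrix of `τ` for the observables `z ^ l`, `|l| < n`, and `m`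
equidistant points on the unit circle. -/
def edmdMatrix (τ : ℂ → ℂ) (α : ℝ) (m n : ℕ) : Matrix (LaurentIndex n) (LaurentIndex n) ℂ :=
  edmdM τ (laurentObservable n) (equispacedPoint α m)

/-- The element of `H²(A_r^c)` given by the Laurent polynomial `∑_{|k| < n} ξ_k z ^ k`. -/
def laurentVector (r : ℝ) {n : ℕ} (ξ : LaurentIndex n → ℂ) : HardyCompl r :=
  ((∑ k, ξ k • LaurentSpace.monomial r k : LaurentSpace r) : HardyCompl r)

end

noncomputable section

/-! ### Fourier coefficients on the unit circle -/

/-! With r = e^{-ρ}, the matrix of the Koopman operator in the orthonormal basis of normalised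
monomials has entries c_l(τ^k) e^{ρ|k| - ρ|l|}. Near the unit circle log|τ(z)| lies, up to
orientation, between γ log|z| and Γ log|z|, where γ > 1 and Γ exceeds the maximal derivative as
little as desired. Shifting the contour of c_l(τ^k) gives two bounds (`exists_fourier_bounds`). A
circle on the side where |τ|^k is small, with log-radius slightly below ρ in modulus, makes the
rescaled entries at most e^{-κ(|k|+|l|)}; hence the operator exists and is Hilbert–Schmidt. The
circles of radius e^{±ρ} give |c_l(τ^k)| ≤ e^{ρΓ|k| - ρ|l|}, which controls aliasing.

For m ≥ 2n the monomials are orthonormal on the sample points, so H = 1 and M = G. An entry of G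
differs from c_l(τ^k) only by Fourier coefficients of index |q| ≥ m - |l|. After rescaling, this
error is essentially e^{ρ((Γ+1)|k| - m)}. It is exponentially small for |k| < n and m ≥ δn exactly
because δ > Γ + 1; this is the origin of the condition on δ. The transpose of M, extended by zero to
a finite rank operator S_n, therefore converges to C in operator norm at an exponential rate
(`exists_norm_finiteSection_sub_le`).

The rest is perturbation theory. Part (a) holds because the invertible operators form an open set.
For a non-zero spectral point μ, C is a finite rank operator plus an operator of norm below |μ|, so
a Fredholm determinant shows that μ is an eigenvalue and a pole of the resolvent
(`hasEigenvalue_and_pole_of_finite_rank`). If S_n had no spectrum in a small disc about μ, the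
maximum principle for its resolvent would put μ into the resolvent set of C
(`exists_mem_spectrum_near_pole`). The point μ = 0 needs another argument, since S_n always has a
kernel: the determinant of M is of order e^{-cn²}, so some eigenvalue of M is exponentially small.
Part (c) compares the Riesz integrals of S_n and C over one fixed circle, the former fixing the
generalised eigenvectors of S_n. -/

theorem circleFourierCoeff_eq_circleIntegral (f : ℂ → ℂ) (n : ℤ) :
    circleFourierCoeff f n =
      (2 * Real.pi * Complex.I : ℂ)⁻¹ * ∮ z in C(0, 1), f z * z ^ (-n - 1) := by
  have h : ∀ t : ℝ, deriv (circleMap 0 1) t • (f (circleMap 0 1 t) * circleMap 0 1 t ^ (-n - 1)) =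
      Complex.I * (f (Complex.exp (t * Complex.I)) * Complex.exp (-(n * t * Complex.I))) := by
    intro t
    have h1 : circleMap 0 1 t = Complex.exp (t * Complex.I) := by simp [circleMap]
    have h2 : Complex.exp (-(n * t * Complex.I)) = Complex.exp (t * Complex.I) ^ (-n) := by
      rw [← Complex.exp_int_mul]; congr 1; push_cast; ring
    rw [deriv_circleMap, h1, h2, zpow_sub_one₀ (Complex.exp_ne_zero _), smul_eq_mul]
    field_simp [Complex.exp_ne_zero]
  rw [circleIntegral]
  simp_rw [h]
  rw [intervalIntegral.integral_const_mul, circleFourierCoeff, ← mul_assoc]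
  congr 1
  field_simp [Complex.I_ne_zero]

/-- Contour shift: a function which is holomorphic between the unit circle and the circle of radius
`R` has its Fourier coefficients controlled by its size on the latter. -/
theorem norm_circleFourierCoeff_le {f : ℂ → ℂ} {R B : ℝ} (hR : 0 < R)
    (hd : ∀ z : ℂ, min 1 R ≤ ‖z‖ → ‖z‖ ≤ max 1 R → DifferentiableAt ℂ f z)
    (hB : ∀ z : ℂ, ‖z‖ = R → ‖f z‖ ≤ B) (n : ℤ) :
    ‖circleFourierCoeff f n‖ ≤ B * R ^ (-n) := by
  have hd' : ∀ z : ℂ, min 1 R ≤ ‖z‖ → ‖z‖ ≤ max 1 R →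
      DifferentiableAt ℂ (fun z => f z * z ^ (-n - 1)) z := by
    intro z h1 h2
    have hz : z ≠ 0 := by
      rintro rfl
      simp at h1
      linarith [lt_min one_pos hR, min_le_iff.mpr h1]
    exact (hd z h1 h2).mul (differentiableAt_zpow.mpr (Or.inl hz))
  have hI : ∮ z in C(0, 1), f z * z ^ (-n - 1) = ∮ z in C(0, R), f z * z ^ (-n - 1) := by
    rcases le_total 1 R with h | h
    · rw [max_eq_right h, min_eq_left h] at hd'
      refine (Complex.circleIntegral_eq_of_differentiable_on_annulus_off_countable one_pos h
        Set.countable_empty (fun z hz => ?_) fun z hz => ?_).symm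
      · simp only [Set.mem_sdiff, Metric.mem_closedBall, dist_zero_right, Metric.mem_ball,
          not_lt] at hz
        exact (hd' z hz.2 hz.1).continuousAt.continuousWithinAt
      · simp only [Set.mem_sdiff, Metric.mem_closedBall, dist_zero_right, Metric.mem_ball,
          not_le] at hz
        exact hd' z hz.1.2.le hz.1.1.le
    · rw [max_eq_left h, min_eq_right h] at hd'
      refine Complex.circleIntegral_eq_of_differentiable_on_annulus_off_countable hR h
        Set.countable_empty (fun z hz => ?_) fun z hz => ?_
      · simp only [Set.mem_sdiff, Metric.mem_closedBall, dist_zero_right, Metric.mem_ball,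
          not_lt] at hz
        exact (hd' z hz.2 hz.1).continuousAt.continuousWithinAt
      · simp only [Set.mem_sdiff, Metric.mem_closedBall, dist_zero_right, Metric.mem_ball,
          not_le] at hz
        exact hd' z hz.1.2.le hz.1.1.le
  rw [circleFourierCoeff_eq_circleIntegral, hI, ← smul_eq_mul]
  refine (circleIntegral.norm_two_pi_i_inv_smul_integral_le_of_norm_le_const hR.le
    (C := B * R ^ (-n - 1)) fun z hz => ?_).trans ?_
  · have hz : ‖z‖ = R := by simpa using hz
    rw [norm_mul, norm_zpow, hz]
    exact mul_le_mul_of_nonneg_right (hB z hz) (zpow_nonneg hR.le _)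
  · rw [zpow_sub_one₀ hR.ne']
    apply le_of_eq
    field_simp

/-- The Fourier series converges to the function if the coefficients are summable. -/
theorem hasSum_circleFourierCoeff {f : ℂ → ℂ} (hf : ContinuousOn f (Metric.sphere 0 1))
    (hs : Summable (circleFourierCoeff f)) {z : ℂ} (hz : ‖z‖ = 1) :
    HasSum (fun n : ℤ => circleFourierCoeff f n * z ^ n) (f z) := by
  have : Fact (0 < 2 * Real.pi) := ⟨Real.two_pi_pos⟩
  let F : C(AddCircle (2 * Real.pi), ℂ) :=
    ⟨fun x => f (AddCircle.toCircle x), by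
      refine hf.comp_continuous (continuous_subtype_val.comp AddCircle.continuous_toCircle) ?_
      intro x; simp [Circle.norm_coe]⟩
  have hT : ∀ t : ℝ, ((AddCircle.toCircle (t : AddCircle (2 * Real.pi)) : Circle) : ℂ) =
      Complex.exp (t * Complex.I) := by
    intro t
    rw [AddCircle.toCircle_apply_mk, Circle.coe_exp, div_self Real.two_pi_pos.ne', one_mul]
  have hfour : ∀ (n : ℤ) (t : ℝ), fourier n (t : AddCircle (2 * Real.pi)) =
      Complex.exp (t * Complex.I) ^ n := by
    intro n t
    rw [fourier_coe_apply, ← Complex.exp_int_mul]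
    congr 1
    push_cast
    field_simp
  have hc : ∀ n, fourierCoeff F n = circleFourierCoeff f n := by
    intro n
    rw [fourierCoeff_eq_intervalIntegral F n 0, circleFourierCoeff, zero_add]
    rw [← Complex.coe_smul, smul_eq_mul]
    congr 1
    · push_cast; simp
    · refine intervalIntegral.integral_congr fun t _ => ?_
      simp only [F, ContinuousMap.coe_mk, hT, hfour, smul_eq_mul]
      rw [mul_comm, ← Complex.exp_int_mul]
      congr 2
      push_cast; ring
  have hz' : Complex.exp (z.arg * Complex.I) = z := by
    have := Complex.norm_mul_exp_arg_mul_I z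
    rwa [hz, Complex.ofReal_one, one_mul] at this
  have key := has_pointwise_sum_fourier_series_of_summable (f := F)
    (by simpa only [funext hc] using hs) (z.arg : AddCircle (2 * Real.pi))
  simp only [hc, hfour, hz', smul_eq_mul] at key
  simpa only [F, ContinuousMap.coe_mk, hT, hz'] using key

/-! ### Averages over equidistant points -/

theorem equispacedPoint_ne_zero (α : ℝ) (m : ℕ) (j : Fin m) : equispacedPoint α m j ≠ 0 :=
  Complex.exp_ne_zero _

theorem norm_equispacedPoint (α : ℝ) (m : ℕ) (j : Fin m) : ‖equispacedPoint α m j‖ = 1 := by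
  have : (2 * Real.pi * Complex.I * (j : ℕ) / m + Complex.I * α : ℂ) =
      ((2 * Real.pi * (j : ℕ) / m + α : ℝ) : ℂ) * Complex.I := by
    push_cast; ring
  rw [equispacedPoint, this, Complex.norm_exp_ofReal_mul_I]

/-- The average of `z ^ s` over the equidistant points. -/
def equispacedMean (α : ℝ) (m : ℕ) (s : ℤ) : ℂ := (m : ℂ)⁻¹ * ∑ j, equispacedPoint α m j ^ s

theorem equispacedMean_zero (α : ℝ) {m : ℕ} (hm : 0 < m) : equispacedMean α m 0 = 1 := by
  have : (m : ℂ) ≠ 0 := by exact_mod_cast hm.ne'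
  simp [equispacedMean, this]

theorem norm_equispacedMean_le (α : ℝ) (m : ℕ) (s : ℤ) : ‖equispacedMean α m s‖ ≤ 1 := by
  rw [equispacedMean, norm_mul, norm_inv, Complex.norm_natCast]
  have : ‖∑ j, equispacedPoint α m j ^ s‖ ≤ m := by
    refine (norm_sum_le _ _).trans ?_
    simp [norm_zpow, norm_equispacedPoint]
  calc (m : ℝ)⁻¹ * ‖∑ j, equispacedPoint α m j ^ s‖ ≤ (m : ℝ)⁻¹ * m := by gcongr
    _ ≤ 1 := inv_mul_le_one

/-- Up to a phase this is a geometric sum over the powers of an m-th root of unity, which differs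
from 1 because m does not divide s. -/
theorem equispacedMean_eq_zero (α : ℝ) {m : ℕ} {s : ℤ} (hs : s ≠ 0) (hsm : |s| < m) :
    equispacedMean α m s = 0 := by
  have hm : m ≠ 0 := by rintro rfl; simp at hsm; exact absurd (abs_nonneg s) (by omega)
  have hm' : (m : ℂ) ≠ 0 := by exact_mod_cast hm
  set w : ℂ := Complex.exp (2 * Real.pi * Complex.I / m) with hw
  have hprim : IsPrimitiveRoot w m := Complex.isPrimitiveRoot_exp m hm
  have hpt : ∀ j : Fin m, equispacedPoint α m j ^ s =
      Complex.exp (Complex.I * α) ^ s * (w ^ s) ^ (j : ℕ) := by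
    intro j
    have : equispacedPoint α m j = w ^ (j : ℕ) * Complex.exp (Complex.I * α) := by
      rw [equispacedPoint, Complex.exp_add, hw, ← Complex.exp_nat_mul]
      congr 2; ring
    rw [this, mul_zpow, mul_comm, ← zpow_natCast, ← zpow_natCast, ← zpow_mul, ← zpow_mul,
      mul_comm (_ : ℤ) s]
  have hne : w ^ s ≠ 1 := by
    rw [Ne, hprim.zpow_eq_one_iff_dvd]
    intro hdvd
    exact hs (Int.eq_zero_of_abs_lt_dvd hdvd hsm)
  have hone : (w ^ s) ^ m = 1 := by
    rw [← zpow_natCast, ← zpow_mul, mul_comm, zpow_mul, zpow_natCast, hprim.pow_eq_one, one_zpow]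
  rw [equispacedMean]
  simp_rw [hpt]
  rw [← Finset.mul_sum, Fin.sum_univ_eq_sum_range (fun j => (w ^ s) ^ j) m, geom_sum_eq hne, hone]
  simp

/-- Aliasing: the discrete Fourier coefficient differs from the Fourier coefficient only by
contributions of frequencies at distance at least `m`. -/
theorem norm_equispaced_fourier_sub_le {f : ℂ → ℂ} (hf : ContinuousOn f (Metric.sphere 0 1))
    (hs : Summable fun n => ‖circleFourierCoeff f n‖) (α : ℝ) {m : ℕ} (hm : 0 < m) (l : ℤ)
    {D : ℝ} (hD : 0 ≤ D) {u : ℤ → ℝ} (hu : Summable u) (hu0 : ∀ q, 0 ≤ u q)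
    (hc : ∀ q : ℤ, (m : ℤ) ≤ |q - l| → ‖circleFourierCoeff f q‖ ≤ D * u q) :
    ‖(m : ℂ)⁻¹ * ∑ j, f (equispacedPoint α m j) *
        (starRingEnd ℂ) (equispacedPoint α m j ^ l) - circleFourierCoeff f l‖ ≤ D * ∑' q, u q := by
  have hpt : ∀ j : Fin m, HasSum (fun q : ℤ => circleFourierCoeff f q *
      equispacedPoint α m j ^ (q - l))
      (f (equispacedPoint α m j) * (starRingEnd ℂ) (equispacedPoint α m j ^ l)) := by
    intro j
    have h := (hasSum_circleFourierCoeff hf hs.of_norm (norm_equispacedPoint α m j)).mul_right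
      ((starRingEnd ℂ) (equispacedPoint α m j ^ l))
    refine h.congr_fun fun q => ?_
    have hconj : (starRingEnd ℂ) (equispacedPoint α m j) = (equispacedPoint α m j)⁻¹ := by
      rw [Complex.inv_eq_conj (norm_equispacedPoint α m j)]
    rw [map_zpow₀, hconj, zpow_sub₀ (equispacedPoint_ne_zero α m j), inv_zpow]
    ring
  have hsum : HasSum (fun q : ℤ => circleFourierCoeff f q * equispacedMean α m (q - l))
      ((m : ℂ)⁻¹ * ∑ j, f (equispacedPoint α m j) *
        (starRingEnd ℂ) (equispacedPoint α m j ^ l)) := by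
    have h := (hasSum_sum (s := Finset.univ) fun j _ => hpt j).mul_left (m : ℂ)⁻¹
    refine h.congr_fun fun q => ?_
    rw [equispacedMean, ← Finset.mul_sum]
    ring
  -- The term q = l is the Fourier coefficient itself, and the means vanish for 0 < |q - l| < m.
  have hsub := hsum.sub (hasSum_ite_eq l (circleFourierCoeff f l))
  rw [← hsub.tsum_eq, ← tsum_mul_left]
  refine tsum_of_norm_bounded (hu.mul_left D).hasSum fun q => ?_
  by_cases hq : q = l
  · subst hq
    simpa [equispacedMean_zero α hm] using mul_nonneg hD (hu0 q)
  · rw [if_neg hq, sub_zero]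
    by_cases hql : |q - l| < m
    · rw [equispacedMean_eq_zero α (sub_ne_zero.mpr hq) hql, mul_zero, norm_zero]
      exact mul_nonneg hD (hu0 q)
    · rw [norm_mul]
      calc _ ≤ ‖circleFourierCoeff f q‖ * 1 := by gcongr; exact norm_equispacedMean_le _ _ _
        _ ≤ _ := by rw [mul_one]; exact hc q (not_lt.mp hql)

end
noncomputable section

/-! ### Analytic circle maps near the unit circle -/

theorem isOpen_annulus (r : ℝ) : IsOpen (annulus r) :=
  (isOpen_lt continuous_const continuous_norm).inter (isOpen_lt continuous_norm continuous_const)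

theorem mem_annulus_of_norm_eq_one {r : ℝ} (h0 : 0 < r) (h1 : r < 1) {z : ℂ} (hz : ‖z‖ = 1) :
    z ∈ annulus r := by
  refine ⟨by rw [hz]; exact h1, ?_⟩
  rw [hz]
  exact (one_lt_inv₀ h0).mpr h1

theorem exp_zpow (x : ℝ) (n : ℤ) : Real.exp x ^ n = Real.exp (n * x) := by
  rw [← Real.rpow_intCast, ← Real.exp_mul, mul_comm]

/-- The logarithmic derivative `z τ'(z) / τ(z)`. -/
def angularDeriv (τ : ℂ → ℂ) (z : ℂ) : ℂ := z * deriv τ z / τ z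

namespace IsAnalyticExpandingCircleMap

variable {τ : ℂ → ℂ}

theorem differentiableAt (hτ : IsAnalyticExpandingCircleMap τ) {z : ℂ} (hz : ‖z‖ = 1) :
    DifferentiableAt ℂ τ z := by
  obtain ⟨r, h0, h1, hd⟩ := hτ.holomorphic
  exact hd.differentiableAt ((isOpen_annulus r).mem_nhds (mem_annulus_of_norm_eq_one h0 h1 hz))

theorem ne_zero (hτ : IsAnalyticExpandingCircleMap τ) {z : ℂ} (hz : ‖z‖ = 1) : τ z ≠ 0 := by
  rw [← norm_ne_zero_iff, hτ.mapsTo z hz]; exact one_ne_zero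

theorem continuousOn_deriv (hτ : IsAnalyticExpandingCircleMap τ) :
    ContinuousOn (deriv τ) (Metric.sphere 0 1) := by
  obtain ⟨r, h0, h1, hd⟩ := hτ.holomorphic
  refine (hd.deriv (isOpen_annulus r)).continuousOn.mono fun z hz => ?_
  exact mem_annulus_of_norm_eq_one h0 h1 (by simpa using hz)

theorem norm_angularDeriv (hτ : IsAnalyticExpandingCircleMap τ) {z : ℂ} (hz : ‖z‖ = 1) :
    ‖angularDeriv τ z‖ = ‖deriv τ z‖ := by
  simp [angularDeriv, hz, hτ.mapsTo z hz]

/-- The logarithmic derivative is real on the unit circle. -/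
theorem angularDeriv_im (hτ : IsAnalyticExpandingCircleMap τ) {z : ℂ} (hz : ‖z‖ = 1) :
    (angularDeriv τ z).im = 0 := by
  have hz' : Complex.exp ((z.arg : ℂ) * Complex.I) = z := by
    have := Complex.norm_mul_exp_arg_mul_I z
    rwa [hz, Complex.ofReal_one, one_mul] at this
  have h1 : HasDerivAt (fun t : ℝ => Complex.exp ((t : ℂ) * Complex.I)) (z * Complex.I) z.arg := by
    have := ((hasDerivAt_id (z.arg : ℂ)).mul_const Complex.I).cexp.comp_ofReal
    simpa [hz'] using this
  have h2 : HasDerivAt (fun t : ℝ => τ (Complex.exp ((t : ℂ) * Complex.I)))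
      (deriv τ z * (z * Complex.I)) z.arg := by
    refine HasDerivAt.comp (z.arg) (h₂ := τ) ?_ h1
    rw [hz']
    exact (hτ.differentiableAt hz).hasDerivAt
  -- Differentiating |τ(e^{it})|² = 1 gives Re(i z τ'(z) conj(τ(z))) = 0, and conj(τ(z)) = 1/τ(z) on
  -- the circle.
  have h3 := h2.norm_sq
  have h4 : (fun t : ℝ => ‖τ (Complex.exp ((t : ℂ) * Complex.I))‖ ^ 2) = fun _ => 1 := by
    funext t
    rw [hτ.mapsTo _ (Complex.norm_exp_ofReal_mul_I t), one_pow]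
  rw [h4, hz'] at h3
  have h5 := h3.unique (hasDerivAt_const _ _)
  rw [Complex.inner] at h5
  have h6 : (starRingEnd ℂ) (τ z) = (τ z)⁻¹ := (Complex.inv_eq_conj (hτ.mapsTo z hz)).symm
  have h7 : deriv τ z * (z * Complex.I) * (starRingEnd ℂ) (τ z) = angularDeriv τ z * Complex.I := by
    rw [h6, angularDeriv]; ring
  rw [h7, Complex.mul_I_re] at h5
  linarith

/-- Up to a sign, the logarithmic derivative is the modulus of the derivative. -/
theorem exists_sign (hτ : IsAnalyticExpandingCircleMap τ) :
    ∃ σ : ℝ, (σ = 1 ∨ σ = -1) ∧ ∀ z : ℂ, ‖z‖ = 1 → σ * (angularDeriv τ z).re = ‖deriv τ z‖ := by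
  have hconn : IsPreconnected (Metric.sphere (0 : ℂ) 1) :=
    isPreconnected_sphere (by rw [Complex.rank_real_complex]; exact Nat.one_lt_ofNat) 0 1
  have hτc : ContinuousOn τ (Metric.sphere 0 1) := fun z hz =>
    (hτ.differentiableAt (by simpa using hz)).continuousAt.continuousWithinAt
  have hcont : ContinuousOn (fun z => (angularDeriv τ z).re) (Metric.sphere 0 1) :=
    Complex.continuous_re.comp_continuousOn
      ((continuousOn_id.mul hτ.continuousOn_deriv).div hτc fun z hz =>
        hτ.ne_zero (by simpa using hz))
  -- Two continuous functions with equal squares on the connected circle agree up to one global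
  -- sign, as |τ'| does not vanish.
  have hsq : Set.EqOn ((fun z => (angularDeriv τ z).re) ^ 2) ((fun z => ‖deriv τ z‖) ^ 2)
      (Metric.sphere 0 1) := by
    intro z hz
    have hz : ‖z‖ = 1 := by simpa using hz
    simp only [Pi.pow_apply]
    rw [← hτ.norm_angularDeriv hz, ← Complex.normSq_eq_norm_sq, Complex.normSq_apply,
      hτ.angularDeriv_im hz]
    ring
  rcases hconn.eq_or_eq_neg_of_sq_eq hcont hτ.continuousOn_deriv.norm hsq (fun {z} hz => by
      have := hτ.expanding z (by simpa using hz)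
      exact (one_pos.trans this).ne') with h | h
  · exact ⟨1, Or.inl rfl, fun z hz => by simpa using h (by simpa using hz)⟩
  · refine ⟨-1, Or.inr rfl, fun z hz => ?_⟩
    have : (angularDeriv τ z).re = -‖deriv τ z‖ := h (by simpa using hz)
    rw [this]; ring

theorem norm_deriv_le_maxDeriv (hτ : IsAnalyticExpandingCircleMap τ) {z : ℂ} (hz : ‖z‖ = 1) :
    ‖deriv τ z‖ ≤ maxDeriv τ := by
  have hbdd : BddAbove (Set.range fun z : Circle => ‖deriv τ (z : ℂ)‖) := by
    obtain ⟨B, hB⟩ := (isCompact_sphere (0 : ℂ) 1).exists_bound_of_continuousOn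
      hτ.continuousOn_deriv
    exact ⟨B, by rintro _ ⟨w, rfl⟩; exact hB w (by simp [Circle.norm_coe])⟩
  exact le_ciSup hbdd ⟨z, by simpa [Submonoid.unitSphere] using hz⟩

/-- On circles of radius close to `1`, `log |τ|` lies between multiples of `log |z|` (up to the
sign `σ`, the orientation of `τ`), with factors arbitrarily close to the extremal derivatives. -/
theorem exists_log_norm_bounds (hτ : IsAnalyticExpandingCircleMap τ) {δ : ℝ}
    (hδ : 1 + maxDeriv τ < δ) :
    ∃ ρ γ Γ σ : ℝ, 0 < ρ ∧ 1 < γ ∧ γ ≤ Γ ∧ Γ + 1 < δ ∧ (σ = 1 ∨ σ = -1) ∧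
      ∀ x : ℝ, |x| ≤ ρ → ∀ z : ℂ, ‖z‖ = Real.exp x →
        DifferentiableAt ℂ τ z ∧ τ z ≠ 0 ∧
        (0 ≤ x → γ * x ≤ σ * Real.log ‖τ z‖ ∧ σ * Real.log ‖τ z‖ ≤ Γ * x) ∧
        (x ≤ 0 → Γ * x ≤ σ * Real.log ‖τ z‖ ∧ σ * Real.log ‖τ z‖ ≤ γ * x) := by
  obtain ⟨r, h0, h1, hd⟩ := hτ.holomorphic
  obtain ⟨σ, hσ, hσh⟩ := hτ.exists_sign
  obtain ⟨z₀, hz₀, hmin⟩ := (isCompact_sphere (0 : ℂ) 1).exists_isMinOn ⟨1, by simp⟩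
    hτ.continuousOn_deriv.norm
  -- Strict inequalities γ < min|τ'| and Γ > max|τ'| leave room to move off the circle, while Γ < δ
  -- - 1 is kept.
  obtain ⟨γ, hγ1, hγ⟩ := exists_between (hτ.expanding z₀ (by simpa using hz₀))
  obtain ⟨Γ, hΓ, hΓδ⟩ := exists_between (show maxDeriv τ < δ - 1 by linarith)
  have hγΓ : γ ≤ Γ := by linarith [hτ.norm_deriv_le_maxDeriv (z := z₀) (by simpa using hz₀)]
  have hV : IsOpen (annulus r ∩ τ ⁻¹' {0}ᶜ) :=
    hd.continuousOn.isOpen_inter_preimage (isOpen_annulus r) isOpen_compl_singleton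
  have hhc : ContinuousOn (fun z => σ * (angularDeriv τ z).re) (annulus r ∩ τ ⁻¹' {0}ᶜ) := by
    refine continuousOn_const.mul (Complex.continuous_re.comp_continuousOn ?_)
    exact (continuousOn_id.mul ((hd.deriv (isOpen_annulus r)).continuousOn.mono
      Set.inter_subset_left)).div (hd.continuousOn.mono Set.inter_subset_left) fun z hz => hz.2
  have hW := hhc.isOpen_inter_preimage hV (isOpen_Ioo (a := γ) (b := Γ))
  have hsub : Metric.sphere (0 : ℂ) 1 ⊆ (annulus r ∩ τ ⁻¹' {0}ᶜ) ∩
      (fun z => σ * (angularDeriv τ z).re) ⁻¹' Set.Ioo γ Γ := by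
    intro z hz
    have hz' : ‖z‖ = 1 := by simpa using hz
    refine ⟨⟨mem_annulus_of_norm_eq_one h0 h1 hz', hτ.ne_zero hz'⟩, ?_⟩
    rw [Set.mem_preimage, hσh z hz']
    exact ⟨hγ.trans_le (hmin hz), (hτ.norm_deriv_le_maxDeriv hz').trans_lt hΓ⟩
  -- Compactness gives a uniform collar of width d. The choice ρ = log(1 + d) stays inside it, since
  -- |e^x - 1| ≤ e^{|x|} - 1 ≤ d for |x| ≤ ρ.
  obtain ⟨d, hd0, hdW⟩ := (isCompact_sphere (0 : ℂ) 1).exists_cthickening_subset_open hW hsub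
  have hρ : 0 < Real.log (1 + d) := Real.log_pos (by linarith)
  have hmem : ∀ x : ℝ, |x| ≤ Real.log (1 + d) → ∀ w : ℂ, ‖w‖ = 1 →
      (Real.exp x : ℂ) * w ∈ (annulus r ∩ τ ⁻¹' {0}ᶜ) ∩
      (fun z => σ * (angularDeriv τ z).re) ⁻¹' Set.Ioo γ Γ := by
    intro x hx w hw
    refine hdW (Metric.mem_cthickening_of_dist_le _ w _ _ (by simpa using hw) ?_)
    have e1 : (Real.exp x : ℂ) * w - w = ((Real.exp x - 1 : ℝ) : ℂ) * w := by push_cast; ring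
    rw [dist_eq_norm, e1, norm_mul, hw, mul_one, Complex.norm_real, Real.norm_eq_abs]
    have e2 : Real.exp |x| ≤ 1 + d := by
      rw [← Real.exp_log (show 0 < 1 + d by linarith)]
      exact Real.exp_le_exp.mpr hx
    rw [abs_le]
    constructor
    · have := Real.add_one_le_exp x
      have := Real.add_one_le_exp |x|
      linarith [neg_abs_le x]
    · have := Real.exp_le_exp.mpr (le_abs_self x)
      linarith
  refine ⟨Real.log (1 + d), γ, Γ, σ, hρ, hγ1, hγΓ, by linarith, hσ, fun x hx z hz => ?_⟩
  obtain ⟨w, hw, rfl⟩ : ∃ w : ℂ, ‖w‖ = 1 ∧ (Real.exp x : ℂ) * w = z := by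
    have he : (Real.exp x : ℂ) ≠ 0 := by exact_mod_cast (Real.exp_pos x).ne'
    refine ⟨z / Real.exp x, ?_, mul_div_cancel₀ _ he⟩
    rw [norm_div, hz, Complex.norm_real, Real.norm_of_nonneg (Real.exp_pos x).le,
      div_self (Real.exp_pos x).ne']
  have hdiff : ∀ y : ℝ, |y| ≤ Real.log (1 + d) → DifferentiableAt ℂ τ ((Real.exp y : ℂ) * w) :=
    fun y hy => hd.differentiableAt ((isOpen_annulus r).mem_nhds (hmem y hy w hw).1.1)
  -- Along a ray, the derivative of log|τ(e^y w)| in y is the real part of the logarithmic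
  -- derivative, which σ brings into (γ, Γ). The bounds follow from the mean value inequality,
  -- starting from log|τ(w)| = 0.
  have hder : ∀ y : ℝ, |y| ≤ Real.log (1 + d) →
      HasDerivAt (fun y : ℝ => σ * Real.log ‖τ ((Real.exp y : ℂ) * w)‖)
        (σ * (angularDeriv τ ((Real.exp y : ℂ) * w)).re) y := by
    intro y hy
    have hne : τ ((Real.exp y : ℂ) * w) ≠ 0 := (hmem y hy w hw).1.2
    have g1 : HasDerivAt (fun y : ℝ => (Real.exp y : ℂ) * w) ((Real.exp y : ℂ) * w) y :=
      (Real.hasDerivAt_exp y).ofReal_comp.mul_const w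
    have g2 : HasDerivAt (fun y : ℝ => τ ((Real.exp y : ℂ) * w))
        (deriv τ ((Real.exp y : ℂ) * w) * ((Real.exp y : ℂ) * w)) y :=
      HasDerivAt.comp y (h₂ := τ) (hdiff y hy).hasDerivAt g1
    have g3 := (g2.norm_sq.log (by simpa using hne)).const_mul (σ / 2)
    have g4 : (fun y : ℝ => σ / 2 * Real.log (‖τ ((Real.exp y : ℂ) * w)‖ ^ 2)) =
        fun y : ℝ => σ * Real.log ‖τ ((Real.exp y : ℂ) * w)‖ := by
      funext y
      rw [Real.log_pow]; push_cast; ring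
    rw [g4] at g3
    refine g3.congr_deriv ?_
    set u := τ ((Real.exp y : ℂ) * w)
    set v := deriv τ ((Real.exp y : ℂ) * w) * ((Real.exp y : ℂ) * w) with hv
    have e3 : angularDeriv τ ((Real.exp y : ℂ) * w) = v / u := by
      rw [angularDeriv, hv, mul_comm]
    rw [e3, Complex.inner, Complex.div_re, ← Complex.normSq_eq_norm_sq]
    have : Complex.normSq u ≠ 0 := by simpa using hne
    simp only [Complex.mul_re, Complex.conj_re, Complex.conj_im]
    field_simp
    ring
  have hconv := convex_Icc (𝕜 := ℝ) (-Real.log (1 + d)) (Real.log (1 + d))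
  have hI : ∀ y ∈ Set.Icc (-Real.log (1 + d)) (Real.log (1 + d)), |y| ≤ Real.log (1 + d) :=
    fun y hy => abs_le.mpr hy
  have hcont : ContinuousOn (fun y : ℝ => σ * Real.log ‖τ ((Real.exp y : ℂ) * w)‖)
      (Set.Icc (-Real.log (1 + d)) (Real.log (1 + d))) := fun y hy =>
    (hder y (hI y hy)).continuousAt.continuousWithinAt
  have hdi : DifferentiableOn ℝ (fun y : ℝ => σ * Real.log ‖τ ((Real.exp y : ℂ) * w)‖)
      (interior (Set.Icc (-Real.log (1 + d)) (Real.log (1 + d)))) := fun y hy =>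
    (hder y (hI y (interior_subset hy))).differentiableAt.differentiableWithinAt
  have hlow := hconv.mul_sub_le_image_sub_of_le_deriv hcont hdi (C := γ) (fun y hy => by
    rw [(hder y (hI y (interior_subset hy))).deriv]
    exact (hmem y (hI y (interior_subset hy)) w hw).2.1.le)
  have hupp := hconv.image_sub_le_mul_sub_of_deriv_le hcont hdi (C := Γ) (fun y hy => by
    rw [(hder y (hI y (interior_subset hy))).deriv]
    exact (hmem y (hI y (interior_subset hy)) w hw).2.2.le)
  have hx' := abs_le.mp hx
  have h0' : (0 : ℝ) ∈ Set.Icc (-Real.log (1 + d)) (Real.log (1 + d)) := ⟨by linarith, hρ.le⟩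
  refine ⟨hdiff x hx, (hmem x hx w hw).1.2, fun hx0 => ?_, fun hx0 => ?_⟩
  · have a1 := hlow 0 h0' x hx' hx0
    have a2 := hupp 0 h0' x hx' hx0
    rw [Real.exp_zero, Complex.ofReal_one, one_mul, hτ.mapsTo w hw, Real.log_one] at a1 a2
    constructor <;> linarith
  · have a1 := hlow x hx' 0 h0' hx0
    have a2 := hupp x hx' 0 h0' hx0
    rw [Real.exp_zero, Complex.ofReal_one, one_mul, hτ.mapsTo w hw, Real.log_one] at a1 a2
    constructor <;> linarith

/-- The weights used for the matrix of the Koopman operator: its entries `c_n(τ ^ k)` decay in both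
directions after rescaling with `e^{-ρ|n|}`, and at the rate `e^{-ρ|n|}` for fixed `k`. -/
theorem exists_fourier_bounds (hτ : IsAnalyticExpandingCircleMap τ) {δ : ℝ}
    (hδ : 1 + maxDeriv τ < δ) :
    ∃ ρ Γ κ : ℝ, 0 < ρ ∧ 1 < Γ ∧ Γ + 1 < δ ∧ 0 < κ ∧
      (∀ k n : ℤ, ‖circleFourierCoeff (fun z => τ z ^ k) n‖ ≤
        Real.exp (ρ * Γ * |(k : ℝ)| - ρ * |(n : ℝ)|)) ∧
      (∀ k n : ℤ, ‖circleFourierCoeff (fun z => τ z ^ k) n‖ ≤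
        Real.exp (-(ρ + κ) * |(k : ℝ)| + (ρ - κ) * |(n : ℝ)|)) := by
  obtain ⟨ρ, γ, Γ, σ, hρ, hγ, hγΓ, hΓ, hσ, H⟩ := hτ.exists_log_norm_bounds hδ
  -- the coefficient bound obtained from the circle with radius `exp x`
  have shift : ∀ (x B : ℝ) (k n : ℤ), |x| ≤ ρ →
      (∀ z : ℂ, ‖z‖ = Real.exp x → k * Real.log ‖τ z‖ ≤ B) →
      ‖circleFourierCoeff (fun z => τ z ^ k) n‖ ≤ Real.exp (B - x * n) := by
    intro x B k n hx hB
    have h := norm_circleFourierCoeff_le (f := fun z => τ z ^ k) (R := Real.exp x)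
      (B := Real.exp B) (Real.exp_pos x) (fun z h1 h2 => ?_) (fun z hz => ?_) n
    · refine h.trans (le_of_eq ?_)
      rw [← Real.exp_log (Real.exp_pos x), exp_zpow, ← Real.exp_add, Real.log_exp]
      congr 1; push_cast; ring
    · have hz0 : 0 < ‖z‖ := lt_of_lt_of_le (lt_min one_pos (Real.exp_pos x)) h1
      have hlog : |Real.log ‖z‖| ≤ ρ := by
        have hx' := abs_le.mp hx
        rw [abs_le, Real.le_log_iff_exp_le hz0, Real.log_le_iff_le_exp hz0]
        constructor
        · refine le_trans (le_min ?_ ?_) h1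
          · exact Real.exp_le_one_iff.mpr (by linarith)
          · exact Real.exp_le_exp.mpr (by linarith)
        · refine h2.trans (max_le ?_ ?_)
          · exact Real.one_le_exp hρ.le
          · exact Real.exp_le_exp.mpr (by linarith)
      obtain ⟨a1, a2, -⟩ := H _ hlog z (Real.exp_log hz0).symm
      exact a1.zpow (Or.inl a2)
    · have hne := (H x hx z hz).2.1
      rw [norm_zpow, ← Real.exp_log (norm_pos_iff.mpr hne), exp_zpow]
      simpa using hB z hz
  have hσσ : σ * σ = 1 := by rcases hσ with rfl | rfl <;> norm_num
  have hσa : ∀ y : ℝ, |σ * y| = |y| := fun y => by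
    rcases hσ with rfl | rfl <;> simp
  have B1 : ∀ k n : ℤ, ‖circleFourierCoeff (fun z => τ z ^ k) n‖ ≤
      Real.exp (ρ * Γ * |(k : ℝ)| - ρ * |(n : ℝ)|) := by
    have hk : ∀ (k : ℤ) (x : ℝ), |x| = ρ → ∀ z : ℂ, ‖z‖ = Real.exp x →
        k * Real.log ‖τ z‖ ≤ ρ * Γ * |(k : ℝ)| := by
      intro k x hx z hz
      obtain ⟨-, -, h1, h2⟩ := H x hx.le z hz
      have h3 : |Real.log ‖τ z‖| ≤ ρ * Γ := by
        rw [← hσa, abs_le]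
        rcases le_total 0 x with h | h
        · rw [abs_of_nonneg h] at hx
          subst hx
          have := h1 h
          constructor <;> nlinarith
        · rw [abs_of_nonpos h] at hx
          obtain rfl : x = -ρ := by linarith
          have := h2 h
          constructor <;> nlinarith
      calc k * Real.log ‖τ z‖ ≤ |k * Real.log ‖τ z‖| := le_abs_self _
        _ = |(k : ℝ)| * |Real.log ‖τ z‖| := abs_mul _ _
        _ ≤ |(k : ℝ)| * (ρ * Γ) := by gcongr
        _ = _ := by ring
    intro k n
    -- The radius e^{ρ} or e^{-ρ} is chosen by the sign of n, so that R^{-n} = e^{-ρ|n|}.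
    rcases le_total 0 n with hn | hn
    · have hn' : |(n : ℝ)| = n := abs_of_nonneg (by exact_mod_cast hn)
      rw [hn']
      exact shift ρ _ k n (abs_of_pos hρ).le (hk k ρ (abs_of_pos hρ))
    · have hn' : |(n : ℝ)| = -n := abs_of_nonpos (by exact_mod_cast hn)
      have hρ' : |-ρ| = ρ := by rw [abs_neg, abs_of_pos hρ]
      have := shift (-ρ) _ k n hρ'.le (hk k (-ρ) hρ')
      rwa [show ρ * Γ * |(k : ℝ)| - -ρ * n = ρ * Γ * |(k : ℝ)| - ρ * |(n : ℝ)| by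
        rw [hn']; ring] at this
  have B2 : ∀ (x : ℝ), 0 ≤ x → x ≤ ρ → ∀ k n : ℤ,
      ‖circleFourierCoeff (fun z => τ z ^ k) n‖ ≤
      Real.exp (-(γ * x) * |(k : ℝ)| + x * |(n : ℝ)|) := by
    intro x hx0 hxρ k n
    have hxa : |x| ≤ ρ := by rwa [abs_of_nonneg hx0]
    have hxa' : |-x| ≤ ρ := by rwa [abs_neg]
    have hkL : ∀ L : ℝ, (k : ℝ) * L = (σ * k) * (σ * L) := fun L => by
      linear_combination (-(k : ℝ) * L) * hσσ
    -- Here the radius follows the sign of σk instead, so that |τ|^k ≤ e^{-γx|k|}; the price is a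
    -- factor of at most e^{x|n|}.
    rcases le_total 0 (σ * k) with hk | hk
    · have hk' : |(k : ℝ)| = σ * k := by rw [← hσa, abs_of_nonneg hk]
      refine (shift (-x) (-(γ * x) * |(k : ℝ)|) k n hxa' fun z hz => ?_).trans
        (Real.exp_le_exp.mpr ?_)
      · have := ((H (-x) hxa' z hz).2.2.2 (by linarith)).2
        rw [hkL, hk']
        nlinarith
      · nlinarith [le_abs_self (n : ℝ)]
    · have hk' : |(k : ℝ)| = -(σ * k) := by rw [← hσa, abs_of_nonpos hk]
      refine (shift x (-(γ * x) * |(k : ℝ)|) k n hxa fun z hz => ?_).trans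
        (Real.exp_le_exp.mpr ?_)
      · have := ((H x hxa z hz).2.2.1 hx0).1
        rw [hkL, hk']
        nlinarith
      · nlinarith [neg_abs_le (n : ℝ)]
  -- take `x` between `ρ / γ` and `ρ`
  refine ⟨ρ, Γ, ρ * (γ - 1) / (γ + 1), hρ, by linarith, hΓ, by
    have : 0 < γ - 1 := by linarith
    positivity, B1, fun k n => ?_⟩
  have hγ1 : γ + 1 ≠ 0 := by linarith
  -- The value x = 2ρ/(γ+1) balances the two gains: ρ - x = γx - ρ, and κ is this common value.
  have hx : ρ - ρ * (γ - 1) / (γ + 1) = 2 * ρ / (γ + 1) := by field_simp; ring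
  have hx' : ρ + ρ * (γ - 1) / (γ + 1) = γ * (2 * ρ / (γ + 1)) := by field_simp; ring
  rw [hx, hx']
  refine B2 _ (by positivity) ?_ k n
  rw [div_le_iff₀ (by linarith)]
  nlinarith

end IsAnalyticExpandingCircleMap

end
noncomputable section

/-! ### Operators with summable matrices -/

section Matrix

variable {ι H : Type*} [NormedAddCommGroup H] [InnerProductSpace ℂ H]

/-- The crude ℓ¹ bound on the basis expansion suffices, because all matrices involved decay
exponentially. -/
theorem HilbertBasis.norm_le_of_norm_inner_le (b : HilbertBasis ι ℂ H) {x : H} {u : ι → ℝ}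
    (hu : Summable u) {K : ℝ} (h : ∀ n, ‖inner ℂ (b n) x‖ ≤ K * u n) : ‖x‖ ≤ K * ∑' n, u n := by
  have hx := b.hasSum_repr x
  rw [← hx.tsum_eq, ← tsum_mul_left]
  refine tsum_of_norm_bounded (hu.mul_left K).hasSum fun n => ?_
  rw [norm_smul, b.orthonormal.1 n, mul_one, HilbertBasis.repr_apply_apply]
  exact h n

theorem HilbertBasis.opNorm_le_of_norm_apply_le (b : HilbertBasis ι ℂ H) (T : H →L[ℂ] H)
    {u : ι → ℝ} (hu : Summable u) (hu0 : ∀ n, 0 ≤ u n) {K : ℝ} (hK : 0 ≤ K)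
    (h : ∀ k, ‖T (b k)‖ ≤ K * u k) : ‖T‖ ≤ K * ∑' n, u n := by
  refine T.opNorm_le_bound (mul_nonneg hK (tsum_nonneg hu0)) fun x => ?_
  have hx := (b.hasSum_repr x).mapL T
  rw [← hx.tsum_eq, ← tsum_mul_left, ← tsum_mul_right]
  refine tsum_of_norm_bounded ((hu.mul_left K).mul_right ‖x‖).hasSum fun n => ?_
  rw [map_smul, norm_smul, mul_comm, HilbertBasis.repr_apply_apply]
  have h1 : ‖inner ℂ (b n) x‖ ≤ ‖x‖ := by
    simpa [b.orthonormal.1 n] using norm_inner_le_norm (𝕜 := ℂ) (b n) x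
  exact mul_le_mul (h n) h1 (norm_nonneg _) (mul_nonneg hK (hu0 n))

/-- An operator is bounded by the sum of (a product bound for) its matrix entries. -/
theorem HilbertBasis.opNorm_le_of_norm_inner_le (b : HilbertBasis ι ℂ H) (T : H →L[ℂ] H)
    {u : ι → ℝ} (hu : Summable u) (hu0 : ∀ n, 0 ≤ u n) {K : ℝ} (hK : 0 ≤ K)
    (h : ∀ n k, ‖inner ℂ (b n) (T (b k))‖ ≤ K * u k * u n) :
    ‖T‖ ≤ K * (∑' n, u n) ^ 2 := by
  have := b.opNorm_le_of_norm_apply_le T hu hu0 (mul_nonneg hK (tsum_nonneg hu0)) fun k =>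
    (b.norm_le_of_norm_inner_le hu fun n => h n k).trans (le_of_eq (by ring))
  exact this.trans (le_of_eq (by ring))

/-- The rank one operators ⟨b_k, ·⟩ F_k are absolutely summable in operator norm, and T is their
sum. -/
theorem HilbertBasis.exists_clm_apply_eq [CompleteSpace H] (b : HilbertBasis ι ℂ H) (F : ι → H)
    (hF : Summable fun k => ‖F k‖) : ∃ T : H →L[ℂ] H, ∀ k, T (b k) = F k := by
  have hs : Summable fun k => (innerSL ℂ (b k)).smulRight (F k) := by
    refine Summable.of_norm_bounded hF fun k => ?_
    rw [ContinuousLinearMap.norm_smulRight_apply, innerSL_apply_norm, b.orthonormal.1 k, one_mul]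
  refine ⟨∑' k, (innerSL ℂ (b k)).smulRight (F k), fun k => ?_⟩
  refine (hs.hasSum.mapL (ContinuousLinearMap.apply ℂ H (b k))).tsum_eq.symm.trans ?_
  rw [tsum_eq_single k fun l hl => ?_]
  · simp [inner_self_eq_norm_sq_to_K, b.orthonormal.1 k]
  · simp [b.orthonormal.2 hl]

/-- `IsHilbertSchmidt` asks for a basis indexed by a subset of H, so b is reindexed by its range. -/
theorem HilbertBasis.isHilbertSchmidt [CompleteSpace H] (b : HilbertBasis ι ℂ H) (T : H →L[ℂ] H)
    (hT : Summable fun k => ‖T (b k)‖ ^ 2) : IsHilbertSchmidt T := by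
  have hrange : Set.range (Subtype.val : Set.range b → H) = Set.range b := Subtype.range_val
  refine ⟨Set.range b, HilbertBasis.mk b.orthonormal.toSubtypeRange ?_, ?_⟩
  · rw [hrange, b.dense_span]
  · have hinj : Function.Injective b := b.orthonormal.linearIndependent.injective
    rw [← (Equiv.ofInjective b hinj).summable_iff]
    refine hT.congr fun k => ?_
    simp

end Matrix

theorem summable_exp_neg_mul_abs {κ : ℝ} (hκ : 0 < κ) :
    Summable fun n : ℤ => Real.exp (-κ * |(n : ℝ)|) := by
  have h : Summable fun n : ℕ => Real.exp (-κ * n) := by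
    have := Real.summable_exp_nat_mul_iff (a := -κ) |>.mpr (by linarith)
    exact this.congr fun n => by rw [mul_comm]
  refine Summable.of_nat_of_neg ?_ ?_ <;> simpa using h

/-! ### The orthonormal basis of `H²(A_r^c)` -/

namespace LaurentSpace

variable {r : ℝ}

theorem coeff_monomial (n : ℤ) : (monomial r n).coeff = Finsupp.single n 1 := rfl

theorem sum_coeff_smul_monomial (p : LaurentSpace r) :
    p = ∑ n ∈ p.coeff.support, p.coeff n • monomial r n := by
  have hinj : Function.Injective (coeff : LaurentSpace r → ℤ →₀ ℂ) :=
    AddMonoidAlgebra.coeff_injective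
  apply hinj
  have hsum : ∀ s : Finset ℤ, (∑ n ∈ s, p.coeff n • monomial r n).coeff =
      ∑ n ∈ s, Finsupp.single n (p.coeff n) := by
    intro s
    induction s using Finset.induction_on with
    | empty => rfl
    | insert a s ha ih =>
      rw [Finset.sum_insert ha, Finset.sum_insert ha, coeff_add, ih, coeff_smul, coeff_monomial,
        Finsupp.smul_single, smul_eq_mul, mul_one]
  rw [hsum]
  exact (Finsupp.sum_single p.coeff).symm

theorem inner_monomial (m n : ℤ) :
    inner ℂ (monomial r m) (monomial r n) = if m = n then ((r ^ (2 * n.natAbs) : ℝ) : ℂ) else 0 := by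
  have h : inner ℂ (monomial r m) (monomial r n) = innerProd (monomial r m) (monomial r n) := rfl
  rw [h, innerProd, coeff_monomial, coeff_monomial, Finsupp.sum_single_index (by simp)]
  split_ifs with hmn
  · simp [hmn]
  · simp [hmn]

end LaurentSpace

variable {r : ℝ}

theorem inner_hardyMonomial (m n : ℤ) : inner ℂ (hardyMonomial r m) (hardyMonomial r n) =
    if m = n then ((r ^ (2 * n.natAbs) : ℝ) : ℂ) else 0 := by
  rw [hardyMonomial, hardyMonomial, UniformSpace.Completion.inner_coe, LaurentSpace.inner_monomial]

theorem norm_hardyMonomial (hr : 0 < r) (n : ℤ) : ‖hardyMonomial r n‖ = r ^ n.natAbs := by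
  have h : ‖hardyMonomial r n‖ ^ 2 = (r ^ n.natAbs) ^ 2 := by
    rw [← pow_mul, mul_comm, ← Complex.ofReal_inj]
    have := inner_self_eq_norm_sq_to_K (𝕜 := ℂ) (hardyMonomial r n)
    rw [inner_hardyMonomial, if_pos rfl] at this
    rw [this]
    push_cast
    rfl
  exact (pow_left_inj₀ (norm_nonneg _) (by positivity) two_ne_zero).mp h

theorem coe_sum_smul_monomial {ι : Type*} (s : Finset ι) (c : ι → ℂ) (k : ι → ℤ) :
    ((∑ i ∈ s, c i • LaurentSpace.monomial r (k i) : LaurentSpace r) : HardyCompl r) =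
      ∑ i ∈ s, c i • hardyMonomial r (k i) := by
  refine (map_sum (UniformSpace.Completion.toComplL (𝕜 := ℂ) (E := LaurentSpace r)) _ _).trans ?_
  refine Finset.sum_congr rfl fun i _ => ?_
  rw [map_smul]
  rfl

theorem coe_eq_sum_hardyMonomial (p : LaurentSpace r) :
    (p : HardyCompl r) = ∑ n ∈ p.coeff.support, p.coeff n • hardyMonomial r n := by
  conv_lhs => rw [p.sum_coeff_smul_monomial]
  exact coe_sum_smul_monomial _ _ _

/-- The normalised monomials. -/
def hardyUnit (r : ℝ) (n : ℤ) : HardyCompl r := ((r ^ n.natAbs : ℝ) : ℂ)⁻¹ • hardyMonomial r n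

theorem orthonormal_hardyUnit (hr : 0 < r) : Orthonormal ℂ (hardyUnit r) := by
  constructor
  · intro n
    rw [hardyUnit, norm_smul, norm_hardyMonomial hr, norm_inv, Complex.norm_real,
      Real.norm_of_nonneg (by positivity)]
    exact inv_mul_cancel₀ (by positivity)
  · intro m n hmn
    simp [hardyUnit, inner_smul_left, inner_smul_right, inner_hardyMonomial, hmn]

theorem hardyMonomial_eq_smul (hr : 0 < r) (n : ℤ) :
    hardyMonomial r n = ((r ^ n.natAbs : ℝ) : ℂ) • hardyUnit r n := by
  rw [hardyUnit, smul_smul, mul_inv_cancel₀, one_smul]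
  exact_mod_cast (pow_pos hr _).ne'

theorem span_hardyUnit (hr : 0 < r) :
    ⊤ ≤ (Submodule.span ℂ (Set.range (hardyUnit r))).topologicalClosure := by
  intro x _
  have hsub : Set.range ((↑) : LaurentSpace r → HardyCompl r) ⊆
      (Submodule.span ℂ (Set.range (hardyUnit r)) : Set (HardyCompl r)) := by
    rintro _ ⟨p, rfl⟩
    rw [coe_eq_sum_hardyMonomial]
    refine Submodule.sum_mem _ fun n _ => Submodule.smul_mem _ _ ?_
    rw [hardyMonomial_eq_smul hr]
    exact Submodule.smul_mem _ _ (Submodule.subset_span ⟨n, rfl⟩)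
  exact closure_mono hsub (UniformSpace.Completion.denseRange_coe x)

/-- The orthonormal basis of normalised monomials. -/
def hardyBasis (hr : 0 < r) : HilbertBasis ℤ ℂ (HardyCompl r) :=
  HilbertBasis.mk (orthonormal_hardyUnit hr) (span_hardyUnit hr)

theorem hardyBasis_apply (hr : 0 < r) (n : ℤ) : hardyBasis hr n = hardyUnit r n := by
  rw [hardyBasis, HilbertBasis.coe_mk]

/-- The coefficient functional of `z ^ n` on `H²(A_r^c)`. -/
def hardyCoeff (r : ℝ) (n : ℤ) : HardyCompl r →L[ℂ] ℂ :=
  ((r ^ n.natAbs : ℝ) : ℂ)⁻¹ • innerSL ℂ (hardyUnit r n)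

theorem inner_hardyUnit (hr : 0 < r) (n : ℤ) (x : HardyCompl r) :
    inner ℂ (hardyUnit r n) x = ((r ^ n.natAbs : ℝ) : ℂ) * hardyCoeff r n x := by
  have : ((r ^ n.natAbs : ℝ) : ℂ) ≠ 0 := by exact_mod_cast (pow_pos hr _).ne'
  simp only [hardyCoeff, _root_.smul_apply, innerSL_apply_apply, smul_eq_mul]
  field_simp

theorem hardyCoeff_hardyMonomial (hr : 0 < r) (n k : ℤ) :
    hardyCoeff r n (hardyMonomial r k) = if n = k then 1 else 0 := by
  have hn : ((r ^ n.natAbs : ℝ) : ℂ) ≠ 0 := by exact_mod_cast (pow_pos hr _).ne'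
  have h := inner_hardyUnit hr n (hardyMonomial r k)
  rw [hardyMonomial_eq_smul hr, inner_smul_right,
    orthonormal_iff_ite.mp (orthonormal_hardyUnit hr), ← hardyMonomial_eq_smul hr] at h
  split_ifs at h ⊢ with hnk
  · subst hnk
    rw [mul_one] at h
    exact (mul_left_cancel₀ hn (by rw [mul_one]; exact h)).symm
  · rw [mul_zero] at h
    exact (mul_eq_zero.mp h.symm).resolve_left hn

/-- The embedding of the span of `z ^ k`, `|k| < n`, into `H²(A_r^c)`. -/
def laurentEmbedding (r : ℝ) (n : ℕ) : (LaurentIndex n → ℂ) →L[ℂ] HardyCompl r :=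
  ∑ k : LaurentIndex n, (ContinuousLinearMap.proj k).smulRight (hardyMonomial r k)

theorem laurentEmbedding_apply (n : ℕ) (ξ : LaurentIndex n → ℂ) :
    laurentEmbedding r n ξ = ∑ k, ξ k • hardyMonomial r k := by
  simp [laurentEmbedding]

theorem laurentEmbedding_eq_laurentVector (n : ℕ) (ξ : LaurentIndex n → ℂ) :
    laurentEmbedding r n ξ = laurentVector r ξ := by
  rw [laurentEmbedding_apply, laurentVector]
  exact (coe_sum_smul_monomial _ _ _).symm

/-- The coefficients of `z ^ k`, `|k| < n`. -/
def laurentTruncation (r : ℝ) (n : ℕ) : HardyCompl r →L[ℂ] (LaurentIndex n → ℂ) :=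
  ContinuousLinearMap.pi fun k => hardyCoeff r k

/-- This left inverse relation is what carries spectra and eigenvectors between matrices and their
finite sections. -/
theorem laurentTruncation_comp_laurentEmbedding (hr : 0 < r) (n : ℕ) :
    laurentTruncation r n ∘L laurentEmbedding r n = ContinuousLinearMap.id ℂ _ := by
  ext1 ξ
  funext l
  simp only [ContinuousLinearMap.comp_apply, laurentEmbedding_apply, laurentTruncation,
    ContinuousLinearMap.coe_pi', map_sum, map_smul,
    ContinuousLinearMap.id_apply, Finset.sum_apply, Pi.smul_apply, hardyCoeff_hardyMonomial hr,
    smul_eq_mul, mul_ite, mul_one, mul_zero, Subtype.coe_inj, Finset.sum_ite_eq, Finset.mem_univ,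
    if_true]

theorem norm_laurentVector_sq (hr : 0 < r) {n : ℕ} (ξ : LaurentIndex n → ℂ) :
    ‖laurentVector r ξ‖ ^ 2 = ∑ k, ‖ξ k‖ ^ 2 * r ^ (2 * (k : ℤ).natAbs) := by
  have hv : laurentVector r ξ =
      ∑ k : LaurentIndex n, (ξ k * ((r ^ (k : ℤ).natAbs : ℝ) : ℂ)) • hardyUnit r k := by
    rw [← laurentEmbedding_eq_laurentVector, laurentEmbedding_apply]
    refine Finset.sum_congr rfl fun k _ => ?_
    rw [hardyMonomial_eq_smul hr, smul_smul]
  have horth : Orthonormal ℂ fun k : LaurentIndex n => hardyUnit r k :=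
    (orthonormal_hardyUnit hr).comp _ Subtype.val_injective
  rw [hv, ← Complex.ofReal_inj]
  have := inner_self_eq_norm_sq_to_K (𝕜 := ℂ)
    (∑ k : LaurentIndex n, (ξ k * ((r ^ (k : ℤ).natAbs : ℝ) : ℂ)) • hardyUnit r k)
  refine (Complex.ofReal_pow _ _).trans (this.symm.trans ?_)
  rw [horth.inner_sum, Complex.ofReal_sum]
  refine Finset.sum_congr rfl fun k _ => ?_
  rw [← Complex.normSq_eq_conj_mul_self, Complex.normSq_eq_norm_sq, norm_mul, Complex.norm_real,
    Real.norm_of_nonneg (by positivity)]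
  push_cast
  ring

end
noncomputable section

/-! ### Perturbation of the spectrum -/

section BanachAlgebra

variable {A : Type*} [NormedRing A] [NormedAlgebra ℂ A]

theorem resolvent_mul_self {T : A} {ζ : ℂ} (h : ζ ∈ resolventSet ℂ T) :
    resolvent T ζ * (algebraMap ℂ A ζ - T) = 1 := Ring.inverse_mul_cancel _ h

theorem self_mul_resolvent {T : A} {ζ : ℂ} (h : ζ ∈ resolventSet ℂ T) :
    (algebraMap ℂ A ζ - T) * resolvent T ζ = 1 := Ring.mul_inverse_cancel _ h

theorem isUnit_algebraMap_sub_iff {T : A} {μ : ℂ} (hμ : μ ≠ 0) :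
    IsUnit (algebraMap ℂ A μ - T) ↔ IsUnit (1 - μ⁻¹ • T) := by
  have h1 : algebraMap ℂ A μ - T = Units.mk0 μ hμ • (1 - μ⁻¹ • T) := by
    rw [Algebra.algebraMap_eq_smul_one, Units.smul_def, smul_sub, smul_smul, Units.val_mk0,
      mul_inv_cancel₀ hμ, one_smul]
  rw [h1, isUnit_smul_iff]

theorem resolvent_sub_resolvent {T S : A} {ζ : ℂ} (hT : ζ ∈ resolventSet ℂ T)
    (hS : ζ ∈ resolventSet ℂ S) :
    resolvent S ζ - resolvent T ζ = resolvent S ζ * (S - T) * resolvent T ζ := by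
  have h : S - T = (algebraMap ℂ A ζ - T) - (algebraMap ℂ A ζ - S) := by abel
  rw [h, mul_sub, sub_mul, mul_assoc, self_mul_resolvent hT, resolvent_mul_self hS, mul_one,
    one_mul]

/-- In the resolvent identity the product term is at most half of ‖R_S(ζ)‖ and can be absorbed on
the left. -/
theorem norm_resolvent_le {T S : A} {ζ : ℂ} (hT : ζ ∈ resolventSet ℂ T)
    (hS : ζ ∈ resolventSet ℂ S) (h : ‖resolvent T ζ‖ * ‖S - T‖ ≤ 1 / 2) :
    ‖resolvent S ζ‖ ≤ 2 * ‖resolvent T ζ‖ := by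
  have h1 := resolvent_sub_resolvent hT hS
  have h2 : ‖resolvent S ζ‖ ≤ ‖resolvent T ζ‖ + ‖resolvent S ζ‖ * (1 / 2) := by
    calc ‖resolvent S ζ‖ = ‖resolvent T ζ + resolvent S ζ * (S - T) * resolvent T ζ‖ := by
          rw [← h1]; congr 1; abel
      _ ≤ ‖resolvent T ζ‖ + ‖resolvent S ζ‖ * ‖S - T‖ * ‖resolvent T ζ‖ :=
          (norm_add_le _ _).trans (add_le_add le_rfl ((norm_mul_le _ _).trans
            (mul_le_mul_of_nonneg_right (norm_mul_le _ _) (norm_nonneg _))))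
      _ ≤ _ := by
          rw [mul_assoc, mul_comm ‖S - T‖]
          gcongr
  linarith

variable [CompleteSpace A]

/-- The invertible elements form an open set, and λ_n - S_n tends to μ - T. -/
theorem mem_spectrum_of_tendsto {T : A} {S : ℕ → A} (hS : Tendsto S atTop (𝓝 T)) {lam : ℕ → ℂ}
    {μ : ℂ} (hlam : Tendsto lam atTop (𝓝 μ)) (h : ∀ᶠ n in atTop, lam n ∈ spectrum ℂ (S n)) :
    μ ∈ spectrum ℂ T := by
  intro hμ
  have ht : Tendsto (fun n => algebraMap ℂ A (lam n) - S n) atTop (𝓝 (algebraMap ℂ A μ - T)) :=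
    (((continuous_algebraMap ℂ A).tendsto μ).comp hlam).sub hS
  obtain ⟨n, hn1, hn2⟩ := (h.and (ht.eventually (Units.isOpen.mem_nhds hμ))).exists
  exact hn1 hn2

/-- Factor ζ - S = (1 - (S - T) R_T(ζ)) (ζ - T); the first factor is inverted by a Neumann series.
-/
theorem mem_resolventSet_of_norm_mul_lt {T S : A} {ζ : ℂ} (hT : ζ ∈ resolventSet ℂ T)
    (h : ‖resolvent T ζ‖ * ‖S - T‖ < 1) : ζ ∈ resolventSet ℂ S := by
  have h1 : IsUnit (1 - (S - T) * resolvent T ζ) := by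
    apply isUnit_one_sub_of_norm_lt_one
    exact (norm_mul_le _ _).trans_lt (by rwa [mul_comm])
  have h2 : algebraMap ℂ A ζ - S = (1 - (S - T) * resolvent T ζ) * (algebraMap ℂ A ζ - T) := by
    rw [sub_mul, mul_assoc, resolvent_mul_self hT]
    noncomm_ring
  rw [spectrum.mem_resolventSet_iff, h2]
  exact h1.mul hT

theorem differentiableAt_resolvent {T : A} {ζ : ℂ} (h : ζ ∈ resolventSet ℂ T) :
    DifferentiableAt ℂ (resolvent T) ζ :=
  (spectrum.hasDerivAt_resolvent_const_left h).differentiableAt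

/-- If the resolvent of `T` has at most a pole at `μ ∈ spec(T)`, then operators which are close to
`T` at an exponential rate have spectral points close to `μ` at an exponential rate. -/
theorem exists_mem_spectrum_near_pole {T : A} {μ : ℂ} (hμ : μ ∈ spectrum ℂ T) {K ε : ℝ} {p : ℕ}
    (hε : 0 < ε) (hres : ∀ ζ : ℂ, 0 < ‖ζ - μ‖ → ‖ζ - μ‖ ≤ ε →
      ζ ∈ resolventSet ℂ T ∧ ‖resolvent T ζ‖ * ‖ζ - μ‖ ^ p ≤ K)
    {S : ℕ → A} {D a : ℝ} (ha : 0 < a) (hS : ∀ᶠ n in atTop, ‖S n - T‖ ≤ D * Real.exp (-a * n)) :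
    ∃ a' : ℝ, 0 < a' ∧ ∀ᶠ n : ℕ in atTop,
      ∃ lam ∈ spectrum ℂ (S n), ‖lam - μ‖ ≤ Real.exp (-a' * n) := by
  have hp : (0 : ℝ) < p + 1 := by positivity
  -- On the circle of radius e = e^{-an/(p+1)} the pole costs at most e^{-p}, while ‖S_n - T‖ ≤ D
  -- e^{p+1}. The product is at most KDe, which tends to zero.
  have ha' : 0 < a / (p + 1) := by positivity
  refine ⟨a / (p + 1), ha', ?_⟩
  have hlim : Tendsto (fun n : ℕ => Real.exp (-(a / (p + 1)) * n)) atTop (𝓝 0) := by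
    refine Real.tendsto_exp_atBot.comp ?_
    exact tendsto_natCast_atTop_atTop.const_mul_atTop_of_neg (neg_lt_zero.mpr ha')
  have hlim2 : Tendsto (fun n : ℕ => K * D * Real.exp (-(a / (p + 1)) * n)) atTop (𝓝 0) := by
    simpa using hlim.const_mul (K * D)
  filter_upwards [hS, hlim.eventually (gt_mem_nhds hε),
    hlim2.eventually (gt_mem_nhds (show (0 : ℝ) < 1 / 4 by norm_num))] with n h1 h2 h3
  set e := Real.exp (-(a / (p + 1)) * n) with he
  have he0 : 0 < e := Real.exp_pos _
  have hexp : Real.exp (-a * n) = e * e ^ p := by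
    rw [← pow_succ', he, ← Real.exp_nat_mul]
    congr 1
    push_cast
    field_simp
  -- Without spectrum of S_n in the closed disc of radius e, its resolvent is holomorphic there. The
  -- maximum principle carries the bound 2‖R_T‖ ≤ 1/(2‖S_n - T‖) from the circle to the centre μ.
  -- Then T, as a small perturbation of S_n, would have μ in its resolvent set.
  by_contra hno
  push Not at hno
  have hin : ∀ ζ ∈ Metric.closedBall μ e, ζ ∈ resolventSet ℂ (S n) := by
    intro ζ hζ
    by_contra hns
    have h4 := hno ζ hns
    rw [Metric.mem_closedBall, dist_eq_norm] at hζ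
    linarith
  have hsmall : ∀ ζ ∈ Metric.sphere μ e,
      ζ ∈ resolventSet ℂ T ∧ ‖resolvent T ζ‖ * ‖S n - T‖ ≤ 1 / 4 := by
    intro ζ hζ
    rw [mem_sphere_iff_norm] at hζ
    obtain ⟨h5, h6⟩ := hres ζ (by rw [hζ]; exact he0) (by rw [hζ]; exact h2.le)
    refine ⟨h5, ?_⟩
    rw [hζ] at h6
    have hD : 0 ≤ D * e := by
      have : 0 ≤ D * (e * e ^ p) := hexp ▸ (norm_nonneg _).trans h1
      rw [← mul_assoc] at this
      exact nonneg_of_mul_nonneg_left this (by positivity)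
    calc ‖resolvent T ζ‖ * ‖S n - T‖ ≤ ‖resolvent T ζ‖ * (D * (e * e ^ p)) := by
          rw [← hexp]; gcongr
      _ = (‖resolvent T ζ‖ * e ^ p) * (D * e) := by ring
      _ ≤ K * (D * e) := mul_le_mul_of_nonneg_right h6 hD
      _ ≤ 1 / 4 := by rw [← mul_assoc]; exact h3.le
  have hmem : μ ∈ resolventSet ℂ (S n) := hin μ (Metric.mem_closedBall_self he0.le)
  rcases eq_or_ne (‖S n - T‖) 0 with hz | hz
  · rw [norm_eq_zero, sub_eq_zero] at hz
    rw [hz] at hmem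
    exact hμ hmem
  have hz' : 0 < ‖S n - T‖ := lt_of_le_of_ne (norm_nonneg _) hz.symm
  have hbound : ‖resolvent (S n) μ‖ ≤ 1 / 2 / ‖S n - T‖ := by
    refine Complex.norm_le_of_forall_mem_frontier_norm_le (f := resolvent (S n))
      (U := Metric.ball μ e) Metric.isBounded_ball ?_ (fun ζ hζ => ?_)
      (subset_closure (Metric.mem_ball_self he0))
    · refine DifferentiableOn.diffContOnCl fun ζ hζ => ?_
      rw [closure_ball μ he0.ne'] at hζ
      exact (differentiableAt_resolvent (hin ζ hζ)).differentiableWithinAt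
    · rw [frontier_ball μ he0.ne'] at hζ
      obtain ⟨h5, h6⟩ := hsmall ζ hζ
      have h7 := norm_resolvent_le h5 (hin ζ (Metric.sphere_subset_closedBall hζ)) (by linarith)
      refine h7.trans ?_
      rw [le_div_iff₀ hz']
      linarith
  refine hμ (mem_resolventSet_of_norm_mul_lt hmem ?_)
  rw [norm_sub_rev]
  calc _ ≤ 1 / 2 / ‖S n - T‖ * ‖S n - T‖ := by gcongr
    _ = 1 / 2 := by field_simp
    _ < 1 := by norm_num

end BanachAlgebra

/-! ### Finite rank perturbations -/

section FiniteRank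

variable {V H : Type*} [NormedAddCommGroup V] [NormedSpace ℂ V] [NormedAddCommGroup H]
  [NormedSpace ℂ H]

/-- This is the identity (1 - XY)⁻¹ = 1 + X(1 - YX)⁻¹Y, here for right inverses and next for left
inverses. The explicit form is needed again for the resolvent in the Fredholm argument. -/
theorem one_sub_comp_mul_inverse (X : V →L[ℂ] H) (Y : H →L[ℂ] V) (Z : V →L[ℂ] V)
    (h1 : (1 - Y ∘L X) * Z = 1) :
    (1 - X ∘L Y) * (1 + X ∘L Z ∘L Y) = 1 := by
  ext x
  have h : Z (Y x) - Y (X (Z (Y x))) = Y x := congr($h1 (Y x))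
  have h' := congr(X $h)
  change (x + X (Z (Y x))) - X (Y (x + X (Z (Y x)))) = x
  rw [map_sub] at h'
  rw [map_add, map_add, ← h']
  abel

theorem inverse_mul_one_sub_comp (X : V →L[ℂ] H) (Y : H →L[ℂ] V) (Z : V →L[ℂ] V)
    (h1 : Z * (1 - Y ∘L X) = 1) :
    (1 + X ∘L Z ∘L Y) * (1 - X ∘L Y) = 1 := by
  ext x
  have h : Z (Y x - Y (X (Y x))) = Y x := congr($h1 (Y x))
  have h' := congr(X $h)
  change (x - X (Y x)) + X (Z (Y (x - X (Y x)))) = x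
  rw [map_sub Y, h']
  abel

theorem isUnit_one_sub_comp (X : V →L[ℂ] H) (Y : H →L[ℂ] V) (h : IsUnit (1 - Y ∘L X)) :
    IsUnit (1 - X ∘L Y) := by
  obtain ⟨u, hu⟩ := h
  exact ⟨⟨_, _, one_sub_comp_mul_inverse X Y ↑u⁻¹ (by rw [← hu]; exact u.mul_inv),
    inverse_mul_one_sub_comp X Y ↑u⁻¹ (by rw [← hu]; exact u.inv_mul)⟩, rfl⟩

theorem mem_spectrum_of_apply_eq_smul {T : H →L[ℂ] H} {μ : ℂ} {w : H} (hw : w ≠ 0)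
    (h : T w = μ • w) : μ ∈ spectrum ℂ T := by
  rintro ⟨u, hu⟩
  apply hw
  have h1 : (u : H →L[ℂ] H) w = 0 := by
    rw [hu, Algebra.algebraMap_eq_smul_one]
    simp [h]
  have h2 : ((↑u⁻¹ : H →L[ℂ] H) * ↑u) w = 0 := by
    change (↑u⁻¹ : H →L[ℂ] H) ((u : H →L[ℂ] H) w) = 0
    rw [h1, map_zero]
  rwa [u.inv_mul] at h2

theorem hasEigenvalue_of_apply_eq_smul {T : H →L[ℂ] H} {μ : ℂ} {w : H} (hw : w ≠ 0)
    (h : T w = μ • w) : Module.End.HasEigenvalue (T : H →ₗ[ℂ] H) μ :=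
  Module.End.hasEigenvalue_of_hasEigenvector
    ⟨Module.End.mem_eigenspace_iff.mpr h, hw⟩

/-- An operator `J T R` with `R J = 1` has no non-zero spectral points except those of `T`. -/
theorem mem_spectrum_of_mem_spectrum_comp {J : V →L[ℂ] H} {R : H →L[ℂ] V} {T : V →L[ℂ] V}
    (hRJ : R ∘L J = 1) {μ : ℂ} (hμ : μ ≠ 0)
    (h : μ ∈ spectrum ℂ (J ∘L T ∘L R)) : μ ∈ spectrum ℂ T := by
  by_contra hT
  rw [spectrum.notMem_iff] at hT
  apply h
  rw [spectrum.mem_resolventSet_iff, isUnit_algebraMap_sub_iff hμ]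
  rw [isUnit_algebraMap_sub_iff hμ] at hT
  -- Read J T R as (J T) R; exchanging the two factors gives R (J T) = T.
  have h1 : R ∘L (μ⁻¹ • (J ∘L T)) = μ⁻¹ • T := by
    rw [ContinuousLinearMap.comp_smul, ← ContinuousLinearMap.comp_assoc, hRJ]
    rfl
  exact isUnit_one_sub_comp (μ⁻¹ • (J ∘L T)) R (h1 ▸ hT)

/-- J v is an eigenvector. Unlike the converse direction, this also covers μ = 0. -/
theorem mem_spectrum_comp_of_apply_eq_smul {J : V →L[ℂ] H} {R : H →L[ℂ] V} {T : V →L[ℂ] V}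
    (hRJ : R ∘L J = 1) {μ : ℂ} {v : V} (hv : v ≠ 0) (h : T v = μ • v) :
    μ ∈ spectrum ℂ (J ∘L T ∘L R) := by
  have hRJ' : ∀ w, R (J w) = w := fun w => congr($hRJ w)
  refine mem_spectrum_of_apply_eq_smul (w := J v) (fun h0 => hv ?_) ?_
  · rw [← hRJ' v, h0, map_zero]
  · simp [hRJ', h]

end FiniteRank

end
noncomputable section

/-! ### Fredholm determinants and poles of the resolvent -/

section Fredholm

variable {ι H : Type*} [Fintype ι] [DecidableEq ι] [NormedAddCommGroup H] [NormedSpace ℂ H]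
  [CompleteSpace H]

/-- The Fredholm determinant of a finite rank perturbation `E + X Y` of `E`: a function `d`, which
is holomorphic off the spectrum of `E`, whose zeros are eigenvalues of `E + X Y`, and such that `d`
times the resolvent of `E + X Y` is continuous. -/
theorem exists_fredholm_determinant (E : H →L[ℂ] H) (X : (ι → ℂ) →L[ℂ] H) (Y : H →L[ℂ] (ι → ℂ)) :
    ∃ (d : ℂ → ℂ) (N : ℂ → H →L[ℂ] H), ∀ ζ ∈ resolventSet ℂ E,
      DifferentiableAt ℂ d ζ ∧ ContinuousAt N ζ ∧
      (d ζ = 0 → ∃ w : H, w ≠ 0 ∧ (E + X ∘L Y) w = ζ • w) ∧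
      (d ζ ≠ 0 → ζ ∈ resolventSet ℂ (E + X ∘L Y) ∧
        resolvent (E + X ∘L Y) ζ = (d ζ)⁻¹ • N ζ) := by
  -- Since ζ - E - XY = (ζ - E)(1 - R_E(ζ) X Y), exchanging factors reduces invertibility to that of
  -- 1 - Y R_E(ζ) X on a finite dimensional space; d is its determinant.
  let G : ℂ → (ι → ℂ) →L[ℂ] (ι → ℂ) := fun ζ => 1 - Y ∘L (resolvent E ζ ∘L X)
  let D : ℂ → Matrix ι ι ℂ := fun ζ => LinearMap.toMatrix' (G ζ : (ι → ℂ) →ₗ[ℂ] (ι → ℂ))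
  let toC : Matrix ι ι ℂ →ₗ[ℂ] ((ι → ℂ) →L[ℂ] (ι → ℂ)) :=
    (LinearMap.toContinuousLinearMap (𝕜 := ℂ) (E := ι → ℂ) (F' := ι → ℂ)).toLinearMap ∘ₗ
      (Matrix.toLin' (R := ℂ) (m := ι) (n := ι)).toLinearMap
  have htoC : ∀ M v, toC M v = Matrix.mulVec M v := fun M v => Matrix.toLin'_apply M v
  have htoCc : Continuous toC := toC.continuous_of_finiteDimensional
  have hD : ∀ ζ v, Matrix.mulVec (D ζ) v = v - Y (resolvent E ζ (X v)) := fun ζ v =>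
    LinearMap.toMatrix'_mulVec _ v
  have hDd : ∀ ζ ∈ resolventSet ℂ E, ∀ i j, DifferentiableAt ℂ (fun ζ => D ζ i j) ζ := by
    intro ζ hζ i j
    let ℓ : (H →L[ℂ] H) →L[ℂ] ℂ := (ContinuousLinearMap.proj i ∘L Y) ∘L
      ContinuousLinearMap.apply ℂ H (X (Pi.single j 1))
    have h : (fun ζ => D ζ i j) = fun ζ => (Pi.single j 1 : ι → ℂ) i - ℓ (resolvent E ζ) := by
      funext ζ
      have := congr_fun (hD ζ (Pi.single j 1)) i
      rw [Matrix.mulVec_single_one] at this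
      exact this
    rw [h]
    exact (differentiableAt_const _).sub
      (ℓ.differentiableAt.comp ζ (differentiableAt_resolvent hζ))
  -- N is d times the resolvent formula R_E + R_E X D⁻¹ Y R_E, with d D⁻¹ written as the adjugate;
  -- hence it is continuous even at zeros of d.
  refine ⟨fun ζ => (D ζ).det, fun ζ => (D ζ).det • resolvent E ζ +
    (resolvent E ζ ∘L X) ∘L toC (D ζ).adjugate ∘L (Y ∘L resolvent E ζ), fun ζ hζ => ?_⟩
  have hdet : DifferentiableAt ℂ (fun ζ => (D ζ).det) ζ := by
    simp_rw [Matrix.det_apply]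
    refine DifferentiableAt.fun_sum fun σ _ => ?_
    refine DifferentiableAt.const_smul ?_ _
    exact DifferentiableAt.fun_finsetProd fun i _ => hDd ζ hζ _ _
  have hDc : ContinuousAt D ζ := by
    refine continuousAt_pi.mpr fun i => continuousAt_pi.mpr fun j => ?_
    exact (hDd ζ hζ i j).continuousAt
  have hR : ContinuousAt (resolvent E) ζ := (differentiableAt_resolvent hζ).continuousAt
  refine ⟨hdet, ?_, fun h0 => ?_, fun h0 => ?_⟩
  · have hadj : ContinuousAt (fun ζ => toC (D ζ).adjugate) ζ :=
      htoCc.continuousAt.comp ((continuous_id.matrix_adjugate).continuousAt.comp hDc)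
    exact (hdet.continuousAt.smul hR).add
      ((hR.clm_comp continuousAt_const).clm_comp (hadj.clm_comp (continuousAt_const.clm_comp hR)))
  · obtain ⟨v, hv, hv0⟩ := Matrix.exists_mulVec_eq_zero_iff.mpr h0
    rw [hD, sub_eq_zero] at hv0
    refine ⟨resolvent E ζ (X v), fun hw => hv ?_, ?_⟩
    · rw [hv0, hw, map_zero]
    · have h1 : ζ • resolvent E ζ (X v) - E (resolvent E ζ (X v)) = X v :=
        congr($(self_mul_resolvent hζ) (X v))
      change E (resolvent E ζ (X v)) + X (Y (resolvent E ζ (X v))) = _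
      rw [← hv0, add_comm]
      exact eq_sub_iff_add_eq.mp h1.symm
  · have hfac : algebraMap ℂ (H →L[ℂ] H) ζ - (E + X ∘L Y) =
        (algebraMap ℂ (H →L[ℂ] H) ζ - E) * (1 - (resolvent E ζ ∘L X) ∘L Y) := by
      have h1 : (resolvent E ζ ∘L X) ∘L Y = resolvent E ζ * (X ∘L Y) := rfl
      rw [h1, mul_sub, ← mul_assoc, self_mul_resolvent hζ, mul_one, one_mul]
      abel
    set Z : (ι → ℂ) →L[ℂ] (ι → ℂ) := (D ζ).det⁻¹ • toC (D ζ).adjugate with hZ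
    have hG : ∀ v, (1 - Y ∘L (resolvent E ζ ∘L X)) v = Matrix.mulVec (D ζ) v := fun v =>
      (hD ζ v).symm
    have hZ1 : (1 - Y ∘L (resolvent E ζ ∘L X)) * Z = 1 := by
      ext1 v
      change (1 - Y ∘L (resolvent E ζ ∘L X)) (Z v) = v
      rw [hG, hZ, _root_.smul_apply, htoC, Matrix.mulVec_smul, Matrix.mulVec_mulVec,
        Matrix.mul_adjugate, Matrix.smul_mulVec, Matrix.one_mulVec, smul_smul, inv_mul_cancel₀ h0,
        one_smul]
    have hZ2 : Z * (1 - Y ∘L (resolvent E ζ ∘L X)) = 1 := by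
      ext1 v
      change Z ((1 - Y ∘L (resolvent E ζ ∘L X)) v) = v
      rw [hG, hZ, _root_.smul_apply, htoC, Matrix.mulVec_mulVec,
        Matrix.adjugate_mul, Matrix.smul_mulVec, Matrix.one_mulVec, smul_smul, inv_mul_cancel₀ h0,
        one_smul]
    have hW1 := one_sub_comp_mul_inverse (resolvent E ζ ∘L X) Y Z hZ1
    have hW2 := inverse_mul_one_sub_comp (resolvent E ζ ∘L X) Y Z hZ2
    have hunit : ζ ∈ resolventSet ℂ (E + X ∘L Y) := by
      rw [spectrum.mem_resolventSet_iff, hfac]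
      exact hζ.mul ⟨⟨_, _, hW1, hW2⟩, rfl⟩
    refine ⟨hunit, ?_⟩
    have hN : (1 + (resolvent E ζ ∘L X) ∘L Z ∘L Y) * resolvent E ζ = (D ζ).det⁻¹ •
        ((D ζ).det • resolvent E ζ +
          (resolvent E ζ ∘L X) ∘L toC (D ζ).adjugate ∘L (Y ∘L resolvent E ζ)) := by
      rw [smul_add, smul_smul, inv_mul_cancel₀ h0, one_smul, add_mul, one_mul, hZ]
      congr 1
      ext x
      change resolvent E ζ (X ((D ζ).det⁻¹ • (toC (D ζ).adjugate (Y (resolvent E ζ x))))) =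
        (D ζ).det⁻¹ • resolvent E ζ (X (toC (D ζ).adjugate (Y (resolvent E ζ x))))
      rw [map_smul, map_smul]
    rw [← hN]
    refine left_inv_eq_right_inv (resolvent_mul_self hunit) ?_
    rw [hfac, mul_assoc, ← mul_assoc (1 - (resolvent E ζ ∘L X) ∘L Y), hW1, one_mul,
      self_mul_resolvent hζ]

/-- Spectral points outside the disc of radius `‖E‖` of a finite rank perturbation of `E` are
eigenvalues, and poles of the resolvent. -/
theorem hasEigenvalue_and_pole_of_finite_rank [Nontrivial H] (E : H →L[ℂ] H)
    (X : (ι → ℂ) →L[ℂ] H) (Y : H →L[ℂ] (ι → ℂ)) {μ : ℂ} (hμ : ‖E‖ < ‖μ‖)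
    (hspec : μ ∈ spectrum ℂ (E + X ∘L Y)) :
    Module.End.HasEigenvalue ((E + X ∘L Y : H →L[ℂ] H) : H →ₗ[ℂ] H) μ ∧
    ∃ (K ε : ℝ) (p : ℕ), 0 < ε ∧ ∀ ζ : ℂ, 0 < ‖ζ - μ‖ → ‖ζ - μ‖ ≤ ε →
      ζ ∈ resolventSet ℂ (E + X ∘L Y) ∧ ‖resolvent (E + X ∘L Y) ζ‖ * ‖ζ - μ‖ ^ p ≤ K := by
  obtain ⟨d, N, h⟩ := exists_fredholm_determinant E X Y
  set T : H →L[ℂ] H := E + X ∘L Y with hT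
  have hμ0 : 0 < ‖μ‖ := (norm_nonneg _).trans_lt hμ
  -- The half plane U = {Re(conj(μ) ζ) > ‖E‖ ‖μ‖} is connected, avoids the disc of radius ‖E‖, and
  -- contains tμ for all t ≥ 1.
  let f : ℂ → ℝ := fun ζ => ((starRingEnd ℂ) μ * ζ).re
  have hf : IsLinearMap ℝ f := ⟨fun x y => by simp [f, mul_add]; ring,
    fun c x => by simp [f]; ring⟩
  have hfc : Continuous f := Complex.continuous_re.comp (continuous_const.mul continuous_id)
  let U : Set ℂ := {ζ | ‖E‖ * ‖μ‖ < f ζ}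
  have hU : IsOpen U := isOpen_lt continuous_const hfc
  have hUconn : IsPreconnected U := (convex_halfSpace_gt hf _).isPreconnected
  have hfμ : f μ = ‖μ‖ * ‖μ‖ := by
    simp only [f]
    rw [← Complex.normSq_eq_conj_mul_self, Complex.ofReal_re, Complex.normSq_eq_norm_sq, sq]
  have hμU : μ ∈ U := by
    change ‖E‖ * ‖μ‖ < f μ
    rw [hfμ]
    gcongr
  have hUres : ∀ ζ ∈ U, ζ ∈ resolventSet ℂ E := by
    intro ζ hζ
    refine spectrum.mem_resolventSet_of_norm_lt ?_
    have h1 : f ζ ≤ ‖μ‖ * ‖ζ‖ := by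
      refine (Complex.re_le_norm _).trans ?_
      rw [norm_mul, RCLike.norm_conj]
    have h2 : ‖E‖ * ‖μ‖ < ‖ζ‖ * ‖μ‖ := by rw [mul_comm ‖ζ‖]; exact lt_of_lt_of_le hζ h1
    exact lt_of_mul_lt_mul_right h2 hμ0.le
  have hdμ : d μ = 0 := by
    by_contra h0
    exact hspec ((h μ (hUres μ hμU)).2.2.2 h0).1
  have han : AnalyticOnNhd ℂ d U :=
    DifferentiableOn.analyticOnNhd (fun ζ hζ => (h ζ (hUres ζ hζ)).1.differentiableWithinAt) hU
  constructor
  · obtain ⟨w, hw, hw'⟩ := (h μ (hUres μ hμU)).2.2.1 hdμ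
    exact hasEigenvalue_of_apply_eq_smul hw hw'
  -- Otherwise d vanishes on U by the identity theorem, and T has an eigenvalue tμ of modulus ‖μ‖ +
  -- ‖T‖ > ‖T‖.
  have hnz : ¬ ∀ᶠ ζ in 𝓝 μ, d ζ = 0 := by
    intro h0
    have hz := han.eqOn_zero_of_preconnected_of_eventuallyEq_zero hUconn hμU h0
    set t : ℝ := 1 + ‖T‖ / ‖μ‖ with ht
    have ht1 : 1 ≤ t := by
      have : 0 ≤ ‖T‖ / ‖μ‖ := by positivity
      linarith
    have htU : t • μ ∈ U := by
      change ‖E‖ * ‖μ‖ < f (t • μ)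
      rw [hf.map_smul, smul_eq_mul, hfμ]
      have : ‖E‖ * ‖μ‖ < ‖μ‖ * ‖μ‖ := by gcongr
      nlinarith [mul_nonneg (sub_nonneg.mpr ht1) (mul_nonneg hμ0.le hμ0.le)]
    obtain ⟨w, hw, hw'⟩ := (h _ (hUres _ htU)).2.2.1 (hz htU)
    have h1 : ‖T w‖ = (‖μ‖ + ‖T‖) * ‖w‖ := by
      rw [hw', norm_smul, norm_smul, Real.norm_of_nonneg (by linarith), ht]
      field_simp
    have h2 := T.le_opNorm w
    have h3 : 0 < ‖w‖ := norm_pos_iff.mpr hw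
    nlinarith
  -- With d = (ζ - μ)^p g and g(μ) ≠ 0, the quantity to be bounded is ‖N‖/|g|, which is continuous
  -- at μ.
  obtain ⟨p, g, hg, hg0, hdg⟩ := (han μ hμU).exists_eventuallyEq_pow_smul_nonzero_iff.mpr hnz
  have hcont : ContinuousAt (fun ζ => ‖N ζ‖ / ‖g ζ‖) μ :=
    (h μ (hUres μ hμU)).2.1.norm.div hg.continuousAt.norm (norm_ne_zero_iff.mpr hg0)
  have hev := (hdg.and (hg.continuousAt.eventually_ne hg0)).and
    ((hcont.eventually (gt_mem_nhds (lt_add_one (‖N μ‖ / ‖g μ‖)))).and (hU.mem_nhds hμU))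
  obtain ⟨ε, hε, hball⟩ := Metric.nhds_basis_closedBall.eventually_iff.mp hev
  refine ⟨‖N μ‖ / ‖g μ‖ + 1, ε, p, hε, fun ζ hζ0 hζε => ?_⟩
  obtain ⟨⟨h1, h2⟩, h3, h4⟩ := hball (by rwa [mem_closedBall_iff_norm])
  have hpow : (ζ - μ) ^ p ≠ 0 := pow_ne_zero _ (norm_pos_iff.mp hζ0)
  have hdne : d ζ ≠ 0 := by
    rw [h1]; exact smul_ne_zero hpow h2
  obtain ⟨h5, h6⟩ := (h ζ (hUres ζ h4)).2.2.2 hdne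
  refine ⟨h5, ?_⟩
  rw [h6, h1, norm_smul, norm_inv, norm_smul, norm_pow]
  have hp : 0 < ‖ζ - μ‖ ^ p := pow_pos hζ0 p
  have hgp : 0 < ‖g ζ‖ := norm_pos_iff.mpr h2
  calc (‖ζ - μ‖ ^ p * ‖g ζ‖)⁻¹ * ‖N ζ‖ * ‖ζ - μ‖ ^ p = ‖N ζ‖ / ‖g ζ‖ := by field_simp
    _ ≤ _ := h3.le

end Fredholm

/-! ### Spectral projections -/

section Riesz

variable {H : Type*} [NormedAddCommGroup H] [NormedSpace ℂ H]

theorem circleIntegral_clm_apply {φ : ℂ → H →L[ℂ] H} {c : ℂ} {R : ℝ}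
    (hφ : CircleIntegrable φ c R) (v : H) :
    (∮ ζ in C(c, R), φ ζ) v = ∮ ζ in C(c, R), φ ζ v := by
  rw [circleIntegral, circleIntegral, ContinuousLinearMap.intervalIntegral_apply hφ.out]
  rfl

variable [CompleteSpace H]

theorem circleIntegrable_resolvent {T : H →L[ℂ] H} {μ : ℂ} {ε : ℝ} (hε : 0 ≤ ε)
    (hT : ∀ ζ ∈ Metric.sphere μ ε, ζ ∈ resolventSet ℂ T) :
    CircleIntegrable (resolvent T) μ ε :=
  ContinuousOn.circleIntegrable hε fun ζ hζ =>
    (differentiableAt_resolvent (hT ζ hζ)).continuousAt.continuousWithinAt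

/-- The Riesz projection fixes the generalised eigenvectors for eigenvalues inside the contour. -/
theorem circleIntegral_resolvent_apply_of_pow_apply_eq_zero {T : H →L[ℂ] H} {μ lam : ℂ} {ε : ℝ}
    (hT : ∀ ζ ∈ Metric.sphere μ ε, ζ ∈ resolventSet ℂ T) (hlam : lam ∈ Metric.ball μ ε)
    {B : H →L[ℂ] H} (hB : ∀ x, B x = T x - lam • x) {N : ℕ} {v : H} (hv : (B ^ N) v = 0) :
    (2 * Real.pi * Complex.I : ℂ)⁻¹ • (∮ ζ in C(μ, ε), resolvent T ζ) v = v := by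
  have hε : 0 < ε := dist_nonneg.trans_lt hlam
  have hne : ∀ ζ ∈ Metric.sphere μ ε, ζ - lam ≠ 0 := by
    intro ζ hζ h0
    rw [sub_eq_zero] at h0
    rw [h0, Metric.mem_sphere] at hζ
    rw [Metric.mem_ball, hζ] at hlam
    exact lt_irrefl _ hlam
  -- On v the Laurent expansion of the resolvent at λ is the finite sum of (ζ - λ)^{-j-1} B^j v,
  -- because B^N v = 0. After integration only the residue term j = 0 survives.
  have htel : ∀ ζ : ℂ, ζ - lam ≠ 0 → ∀ n : ℕ, (algebraMap ℂ (H →L[ℂ] H) ζ - T)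
      (∑ j ∈ Finset.range n, (ζ - lam) ^ (-(j : ℤ) - 1) • (B ^ j) v) =
        v - (ζ - lam) ^ (-(n : ℤ)) • (B ^ n) v := by
    intro ζ hζ n
    induction n with
    | zero => simp
    | succ n ih =>
      have hT' : T ((B ^ n) v) = (B ^ (n + 1)) v + lam • (B ^ n) v := by
        rw [pow_succ']
        change _ = B ((B ^ n) v) + _
        rw [hB]; abel
      rw [Finset.sum_range_succ, map_add, ih]
      have h1 : (algebraMap ℂ (H →L[ℂ] H) ζ - T) ((ζ - lam) ^ (-(n : ℤ) - 1) • (B ^ n) v) =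
          (ζ - lam) ^ (-(n : ℤ) - 1) • (ζ • (B ^ n) v - T ((B ^ n) v)) := by
        rw [map_smul]; rfl
      rw [h1, hT', show ζ • (B ^ n) v - ((B ^ (n + 1)) v + lam • (B ^ n) v) =
        (ζ - lam) • (B ^ n) v - (B ^ (n + 1)) v by rw [sub_smul]; abel, smul_sub, smul_smul,
        zpow_sub_one₀ hζ, mul_assoc, inv_mul_cancel₀ hζ, mul_one]
      have h2 : (ζ - lam) ^ (-((n + 1 : ℕ) : ℤ)) = (ζ - lam) ^ (-(n : ℤ)) * (ζ - lam)⁻¹ := by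
        rw [← zpow_sub_one₀ hζ]; congr 1; push_cast; ring
      rw [h2]
      abel
  have hres : ∀ ζ ∈ Metric.sphere μ ε, resolvent T ζ v =
      ∑ j ∈ Finset.range N, (ζ - lam) ^ (-(j : ℤ) - 1) • (B ^ j) v := by
    intro ζ hζ
    have h1 := htel ζ (hne ζ hζ) N
    rw [hv, smul_zero, sub_zero] at h1
    have h2 := congr($(resolvent_mul_self (hT ζ hζ))
      (∑ j ∈ Finset.range N, (ζ - lam) ^ (-(j : ℤ) - 1) • (B ^ j) v))
    change resolvent T ζ ((algebraMap ℂ (H →L[ℂ] H) ζ - T) _) = _ at h2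
    rw [h1] at h2
    exact h2
  have hint : ∀ j : ℕ, ∮ ζ in C(μ, ε), (ζ - lam) ^ (-(j : ℤ) - 1) • (B ^ j) v =
      if j = 0 then (2 * Real.pi * Complex.I : ℂ) • v else 0 := by
    intro j
    rw [circleIntegral.integral_smul_const]
    split_ifs with hj
    · subst hj
      have : ∮ ζ in C(μ, ε), (ζ - lam) ^ (-((0 : ℕ) : ℤ) - 1) = 2 * Real.pi * Complex.I := by
        simpa using circleIntegral.integral_sub_inv_of_mem_ball hlam
      rw [this, pow_zero]
      rfl
    · rw [circleIntegral.integral_sub_zpow_of_ne (by omega), zero_smul]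
  rw [circleIntegral_clm_apply (circleIntegrable_resolvent hε.le hT),
    circleIntegral.integral_congr hε.le hres, circleIntegral.integral_fun_sum]
  · simp_rw [hint]
    rcases Nat.eq_zero_or_pos N with rfl | hN
    · have : v = 0 := by simpa using hv
      simp [this]
    · rw [Finset.sum_ite_eq' (Finset.range N) 0, if_pos (Finset.mem_range.mpr hN), smul_smul,
        inv_mul_cancel₀ Complex.two_pi_I_ne_zero, one_smul]
  · intro j _
    refine ContinuousOn.circleIntegrable hε.le ?_
    refine ContinuousOn.smul (fun ζ hζ => ?_) continuousOn_const
    exact ((continuousAt_id.sub continuousAt_const).zpow₀ _ (Or.inl (hne ζ hζ))).continuousWithinAt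

/-- Generalised eigenvectors of perturbations of `T`, for eigenvalues inside the contour, are almost
fixed by the Riesz projection of `T`. -/
theorem exists_norm_circleIntegral_resolvent_apply_sub_le {T : H →L[ℂ] H} {μ : ℂ} {ε : ℝ}
    (hε : 0 < ε) (hT : ∀ ζ ∈ Metric.sphere μ ε, ζ ∈ resolventSet ℂ T) :
    ∃ K η : ℝ, 0 < η ∧ ∀ S : H →L[ℂ] H, ‖S - T‖ ≤ η → ∀ lam ∈ Metric.ball μ ε,
      ∀ B : H →L[ℂ] H, (∀ x, B x = S x - lam • x) → ∀ (N : ℕ) (v : H), (B ^ N) v = 0 →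
        ‖((2 * Real.pi * Complex.I : ℂ)⁻¹ • ∮ ζ in C(μ, ε), resolvent T ζ) v - v‖ ≤
          K * ‖S - T‖ * ‖v‖ := by
  obtain ⟨M, hM⟩ := (isCompact_sphere μ ε).exists_bound_of_continuousOn (f := resolvent T)
    fun ζ hζ => (differentiableAt_resolvent (hT ζ hζ)).continuousAt.continuousWithinAt
  have hM0 : 0 ≤ M := (norm_nonneg _).trans
    (hM (μ + ε) (by simp [hε.le]))
  -- The radius η forces ‖R_T‖ ‖S - T‖ ≤ 1/2, hence ‖R_S‖ ≤ 2M; M + 1 avoids dividing by zero. The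
  -- factor ε is the length of the contour over 2π.
  refine ⟨ε * (2 * M * M), 1 / (2 * (M + 1)), by positivity, fun S hS lam hlam B hB N v hv => ?_⟩
  have hsmall : ∀ ζ ∈ Metric.sphere μ ε, ‖resolvent T ζ‖ * ‖S - T‖ ≤ 1 / 2 := by
    intro ζ hζ
    calc ‖resolvent T ζ‖ * ‖S - T‖ ≤ (M + 1) * (1 / (2 * (M + 1))) := by
          gcongr
          exact (hM ζ hζ).trans (by linarith)
      _ = 1 / 2 := by field_simp
  have hSres : ∀ ζ ∈ Metric.sphere μ ε, ζ ∈ resolventSet ℂ S := fun ζ hζ =>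
    mem_resolventSet_of_norm_mul_lt (hT ζ hζ) ((hsmall ζ hζ).trans_lt (by norm_num))
  have hfix := circleIntegral_resolvent_apply_of_pow_apply_eq_zero hSres hlam hB hv
  have hdiff : ‖(2 * Real.pi * Complex.I : ℂ)⁻¹ • ∮ ζ in C(μ, ε), (resolvent S ζ - resolvent T ζ)‖ ≤
      ε * (2 * M * M * ‖S - T‖) := by
    refine circleIntegral.norm_two_pi_i_inv_smul_integral_le_of_norm_le_const hε.le fun ζ hζ => ?_
    rw [resolvent_sub_resolvent (hT ζ hζ) (hSres ζ hζ)]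
    calc _ ≤ ‖resolvent S ζ‖ * ‖S - T‖ * ‖resolvent T ζ‖ := (norm_mul_le _ _).trans
          (mul_le_mul_of_nonneg_right (norm_mul_le _ _) (norm_nonneg _))
      _ ≤ (2 * M) * ‖S - T‖ * M := by
          have h1 := norm_resolvent_le (hT ζ hζ) (hSres ζ hζ) (hsmall ζ hζ)
          have h2 := hM ζ hζ
          gcongr
          linarith
      _ = _ := by ring
  rw [circleIntegral.integral_sub (circleIntegrable_resolvent hε.le hSres)
    (circleIntegrable_resolvent hε.le hT)] at hdiff
  have heq : ((2 * Real.pi * Complex.I : ℂ)⁻¹ • ∮ ζ in C(μ, ε), resolvent T ζ) v - v =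
      -(((2 * Real.pi * Complex.I : ℂ)⁻¹ • ((∮ ζ in C(μ, ε), resolvent S ζ) -
        ∮ ζ in C(μ, ε), resolvent T ζ)) v) := by
    nth_rw 2 [← hfix]
    rw [smul_sub, _root_.sub_apply, _root_.smul_apply, _root_.smul_apply]
    abel
  rw [heq, norm_neg]
  refine (ContinuousLinearMap.le_of_opNorm_le _ hdiff v).trans (le_of_eq (by ring))

end Riesz

end
noncomputable section

/-! ### The smallest eigenvalue of a matrix -/

section SmallEigenvalue

variable {ι : Type*} [Fintype ι] [DecidableEq ι]

/-- The determinant is the product of the eigenvalues with multiplicity, so the smallest modulus is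
at most their geometric mean. -/
theorem Matrix.exists_mem_spectrum_norm_pow_le [Nonempty ι] (M : Matrix ι ι ℂ) :
    ∃ lam ∈ spectrum ℂ M, ‖lam‖ ^ Fintype.card ι ≤ ‖M.det‖ := by
  have hmem : ∀ x, x ∈ M.charpoly.roots ↔ x ∈ spectrum ℂ M := fun x => by
    rw [Polynomial.mem_roots M.charpoly_monic.ne_zero, Matrix.mem_spectrum_iff_isRoot_charpoly]
  have hcard : M.charpoly.roots.card = Fintype.card ι := by
    rw [← (IsAlgClosed.splits M.charpoly).natDegree_eq_card_roots,
      Matrix.charpoly_natDegree_eq_dim]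
  have hne : M.charpoly.roots.toFinset.Nonempty := by
    rw [Multiset.toFinset_nonempty, ← Multiset.card_pos, hcard]
    exact Fintype.card_pos
  obtain ⟨lam, hlam, hmin⟩ := M.charpoly.roots.toFinset.exists_min_image (fun x => ‖x‖) hne
  refine ⟨lam, (hmem lam).mp (Multiset.mem_toFinset.mp hlam), ?_⟩
  rw [Matrix.det_eq_prod_roots_charpoly, ← hcard]
  have key : ∀ s : Multiset ℂ, (∀ x ∈ s, ‖lam‖ ≤ ‖x‖) → ‖lam‖ ^ s.card ≤ ‖s.prod‖ := by
    intro s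
    induction s using Multiset.induction_on with
    | empty => intro; simp
    | cons a s ih =>
      intro h
      rw [Multiset.card_cons, Multiset.prod_cons, norm_mul, pow_succ']
      exact mul_le_mul (h a (Multiset.mem_cons_self a s))
        (ih fun x hx => h x (Multiset.mem_cons_of_mem hx)) (by positivity) (norm_nonneg _)
  exact key _ fun x hx => hmin x (Multiset.mem_toFinset.mpr hx)

/-- Write M = diag(w) E diag(u/w) with entries of E at most K. The weights w cancel in the
determinant, and the Leibniz formula bounds det E by N! K^N, where N is the size. -/
theorem Matrix.norm_det_le_of_weighted (M : Matrix ι ι ℂ) {w u : ι → ℝ} (hw : ∀ k, 0 < w k)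
    (hu : ∀ k, 0 < u k) {K : ℝ} (hM : ∀ k l, ‖M k l‖ * w l ≤ K * w k * u l) :
    ‖M.det‖ ≤ (Fintype.card ι * K) ^ Fintype.card ι * ∏ k, u k := by
  let E : Matrix ι ι ℂ := fun k l => M k l * (w l / (w k * u l) : ℝ)
  have hE : ∀ k l, NormedField.toAbsoluteValue ℂ (E k l) ≤ K := by
    intro k l
    change ‖M k l * (w l / (w k * u l) : ℝ)‖ ≤ K
    rw [norm_mul, Complex.norm_real, Real.norm_of_nonneg (div_pos (hw l) (mul_pos (hw k) (hu l))).le,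
      mul_div_assoc', div_le_iff₀ (mul_pos (hw k) (hu l)), ← mul_assoc]
    exact hM k l
  have hEdet : ‖E.det‖ ≤ (Fintype.card ι).factorial • K ^ Fintype.card ι := Matrix.det_le hE
  have hfac : M = Matrix.of fun k l => ((u l / w l : ℝ) : ℂ) *
      (Matrix.of fun k l => (w k : ℂ) * E k l) k l := by
    ext k l
    have h1 : (w k : ℂ) ≠ 0 := by exact_mod_cast (hw k).ne'
    have h2 : (w l : ℂ) ≠ 0 := by exact_mod_cast (hw l).ne'
    have h3 : (u l : ℂ) ≠ 0 := by exact_mod_cast (hu l).ne'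
    simp only [Matrix.of_apply, E]
    push_cast
    field_simp
  have hdet : M.det = ((∏ k, u k : ℝ) : ℂ) * E.det := by
    rw [hfac, Matrix.det_mul_row, Matrix.det_mul_column, ← mul_assoc, ← Finset.prod_mul_distrib]
    congr 1
    push_cast
    refine Finset.prod_congr rfl fun k _ => ?_
    have h1 : (w k : ℂ) ≠ 0 := by exact_mod_cast (hw k).ne'
    field_simp
  have hupos : 0 ≤ ∏ k, u k := Finset.prod_nonneg fun k _ => (hu k).le
  rw [hdet, norm_mul, Complex.norm_real, Real.norm_of_nonneg hupos, mul_comm]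
  refine mul_le_mul_of_nonneg_right (hEdet.trans ?_) hupos
  rcases isEmpty_or_nonempty ι with h | ⟨⟨k⟩⟩
  · simp
  · have hK : 0 ≤ K := (AbsoluteValue.nonneg _ _).trans (hE k k)
    rw [nsmul_eq_mul, mul_pow]
    refine mul_le_mul_of_nonneg_right ?_ (by positivity)
    exact_mod_cast Nat.factorial_le_pow _

end SmallEigenvalue

theorem card_laurentIndex {n : ℕ} (hn : 1 ≤ n) : Fintype.card (LaurentIndex n) = 2 * n - 1 := by
  rw [Fintype.card_coe, Int.card_Ioo]
  omega

theorem sum_abs_laurentIndex {n : ℕ} (hn : 1 ≤ n) :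
    ∑ k : LaurentIndex n, |((k : ℤ) : ℝ)| = n * (n - 1) := by
  rw [Finset.sum_coe_sort (Finset.Ioo (-(n : ℤ)) n) fun k : ℤ => |(k : ℝ)|]
  induction n, hn using Nat.le_induction with
  | base =>
    have : Finset.Ioo (-((1 : ℕ) : ℤ)) ((1 : ℕ) : ℤ) = {0} := by decide
    rw [this]
    simp
  | succ n hn ih =>
    have h : Finset.Ioo (-((n + 1 : ℕ) : ℤ)) ((n + 1 : ℕ) : ℤ) =
        insert (n : ℤ) (insert (-(n : ℤ)) (Finset.Ioo (-(n : ℤ)) n)) := by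
      ext k
      simp only [Finset.mem_insert, Finset.mem_Ioo]
      omega
    rw [h, Finset.sum_insert, Finset.sum_insert, ih]
    · push_cast
      rw [abs_neg, abs_of_nonneg (by positivity : (0 : ℝ) ≤ n)]
      ring
    · simp
    · simp only [Finset.mem_insert, Finset.mem_Ioo]
      omega

/-- The determinant bound contains e^{-c ∑|l|} = e^{-cn(n-1)}. Its root of order 2n - 1 is at most
e^{-(c/2)(n-1)}, as n/(2n-1) ≥ 1/2. -/
theorem exists_small_mem_spectrum {n : ℕ} (hn : 1 ≤ n)
    (M : Matrix (LaurentIndex n) (LaurentIndex n) ℂ) {w : LaurentIndex n → ℝ} (hw : ∀ k, 0 < w k)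
    {K c : ℝ} (hK : 0 ≤ K) (hc : 0 ≤ c)
    (hM : ∀ k l, ‖M k l‖ * w l ≤ K * w k * Real.exp (-c * |((l : ℤ) : ℝ)|)) :
    ∃ lam ∈ spectrum ℂ M, ‖lam‖ ≤ 2 * n * K * Real.exp (-(c / 2) * (n - 1)) := by
  have : Nonempty (LaurentIndex n) := ⟨⟨0, by simp; omega⟩⟩
  obtain ⟨lam, hlam, hle⟩ := M.exists_mem_spectrum_norm_pow_le
  refine ⟨lam, hlam, ?_⟩
  have hdet := M.norm_det_le_of_weighted hw (fun l => Real.exp_pos (-c * |((l : ℤ) : ℝ)|)) hM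
  rw [← Real.exp_sum, ← Finset.mul_sum, sum_abs_laurentIndex hn] at hdet
  have hcard : ((Fintype.card (LaurentIndex n) : ℕ) : ℝ) = 2 * n - 1 := by
    rw [card_laurentIndex hn, Nat.cast_sub (by omega)]
    push_cast; ring
  have hn' : (1 : ℝ) ≤ n := by exact_mod_cast hn
  have hexp : Real.exp (-c * (n * (n - 1))) ≤
      Real.exp (-(c / 2) * (n - 1)) ^ Fintype.card (LaurentIndex n) := by
    rw [← Real.exp_nat_mul, hcard]
    apply Real.exp_le_exp.mpr
    nlinarith [mul_nonneg hc (sub_nonneg.mpr hn')]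
  have hpow : ‖lam‖ ^ Fintype.card (LaurentIndex n) ≤
      ((2 * n - 1) * K * Real.exp (-(c / 2) * (n - 1))) ^ Fintype.card (LaurentIndex n) := by
    refine hle.trans (hdet.trans ?_)
    rw [mul_pow _ (Real.exp _), ← hcard]
    exact mul_le_mul_of_nonneg_left hexp (by positivity)
  have hb : 0 ≤ (2 * n - 1) * K * Real.exp (-(c / 2) * (n - 1)) := by
    have : (0 : ℝ) ≤ 2 * n - 1 := by linarith
    positivity
  refine (le_of_pow_le_pow_left₀ (by rw [card_laurentIndex hn]; omega) hb hpow).trans ?_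
  gcongr
  linarith

/-! ### The EDMD matrix -/

/-- Two exponents differ by at most 2n - 2 < m, so distinct monomials are orthogonal on the sample
points. -/
theorem edmdH_eq_one (α : ℝ) {m n : ℕ} (hm : 0 < m) (hmn : 2 * n ≤ m) :
    edmdH (laurentObservable n) (equispacedPoint α m) = 1 := by
  ext k l
  have h : edmdH (laurentObservable n) (equispacedPoint α m) k l =
      equispacedMean α m ((k : ℤ) - l) := by
    rw [edmdH, equispacedMean]
    congr 1
    refine Finset.sum_congr rfl fun j _ => ?_
    rw [laurentObservable, laurentObservable, map_zpow₀,
      ← Complex.inv_eq_conj (norm_equispacedPoint α m j),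
      zpow_sub₀ (equispacedPoint_ne_zero α m j), inv_zpow, div_eq_mul_inv]
  rw [h]
  have hk := Finset.mem_Ioo.mp k.2
  have hl := Finset.mem_Ioo.mp l.2
  rcases eq_or_ne k l with rfl | hkl
  · rw [sub_self, equispacedMean_zero α hm, Matrix.one_apply_eq]
  · rw [Matrix.one_apply_ne hkl, equispacedMean_eq_zero]
    · exact sub_ne_zero.mpr fun h => hkl (Subtype.ext h)
    · rw [abs_lt]; omega

theorem edmdMatrix_apply (τ : ℂ → ℂ) (α : ℝ) {m n : ℕ} (hm : 0 < m) (hmn : 2 * n ≤ m)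
    (k l : LaurentIndex n) : edmdMatrix τ α m n k l =
      (m : ℂ)⁻¹ * ∑ j, τ (equispacedPoint α m j) ^ (k : ℤ) *
        (starRingEnd ℂ) (equispacedPoint α m j ^ (l : ℤ)) := by
  rw [edmdMatrix, edmdM, edmdH_eq_one α hm hmn, inv_one, mul_one]
  rfl

/-- The operator on `ℂ^{2n-1}` given by the transpose of the EDMD matrix. -/
def transposeOperator {ι : Type*} [Fintype ι] [DecidableEq ι] (M : Matrix ι ι ℂ) :
    (ι → ℂ) →L[ℂ] (ι → ℂ) :=
  LinearMap.toContinuousLinearMap (Matrix.toLin' M.transpose)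

theorem transposeOperator_apply {ι : Type*} [Fintype ι] [DecidableEq ι] (M : Matrix ι ι ℂ)
    (v : ι → ℂ) : transposeOperator M v = M.transpose.mulVec v := Matrix.toLin'_apply _ _

theorem spectrum_transposeOperator {ι : Type*} [Fintype ι] [DecidableEq ι] (M : Matrix ι ι ℂ) :
    spectrum ℂ (transposeOperator M) = spectrum ℂ M := by
  have h1 : spectrum ℂ (transposeOperator M) = spectrum ℂ (Matrix.toLin' M.transpose) :=
    AlgEquiv.spectrum_eq (Module.End.toContinuousLinearMap (𝕜 := ℂ) (ι → ℂ)) _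
  rw [h1, Matrix.spectrum_toLin']
  ext x
  rw [Matrix.mem_spectrum_iff_isRoot_charpoly, Matrix.mem_spectrum_iff_isRoot_charpoly,
    Matrix.charpoly_transpose]

end
noncomputable section

/-! ### The Koopman operator and its approximations -/

theorem circleFourierCoeff_sum {ι : Type*} (s : Finset ι) (c : ι → ℂ) {f : ι → ℂ → ℂ}
    (hf : ∀ k ∈ s, ContinuousOn (f k) (Metric.sphere 0 1)) (n : ℤ) :
    circleFourierCoeff (fun z => ∑ k ∈ s, c k * f k z) n =
      ∑ k ∈ s, c k * circleFourierCoeff (f k) n := by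
  have hcont : ∀ k ∈ s, Continuous fun t : ℝ => c k * (f k (Complex.exp (t * Complex.I)) *
      Complex.exp (-(n * t * Complex.I))) := by
    intro k hk
    have h1 : Continuous fun t : ℝ => f k (Complex.exp (t * Complex.I)) :=
      (hf k hk).comp_continuous (by fun_prop) fun t => by simp [Complex.norm_exp_ofReal_mul_I]
    exact continuous_const.mul (h1.mul (by fun_prop))
  simp_rw [circleFourierCoeff, Finset.sum_mul, mul_assoc (c _)]
  rw [intervalIntegral.integral_finsetSum fun k hk => (hcont k hk).intervalIntegrable _ _,
    Finset.mul_sum]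
  refine Finset.sum_congr rfl fun k _ => ?_
  rw [intervalIntegral.integral_const_mul]
  ring

theorem IsAnalyticExpandingCircleMap.continuousOn_zpow {τ : ℂ → ℂ}
    (hτ : IsAnalyticExpandingCircleMap τ) (k : ℤ) :
    ContinuousOn (fun z => τ z ^ k) (Metric.sphere 0 1) := fun z hz => by
  have hz : ‖z‖ = 1 := by simpa using hz
  exact ((hτ.differentiableAt hz).continuousAt.zpow₀ k
    (Or.inl (hτ.ne_zero hz))).continuousWithinAt

theorem pow_natAbs_eq_exp {r ρ : ℝ} (hr : r = Real.exp (-ρ)) (n : ℤ) :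
    r ^ n.natAbs = Real.exp (-ρ * |(n : ℝ)|) := by
  rw [hr, ← Real.exp_nat_mul, Nat.cast_natAbs, Int.cast_abs, mul_comm]

theorem nontrivial_hardyCompl {r : ℝ} (hr : 0 < r) : Nontrivial (HardyCompl r) := by
  refine ⟨hardyUnit r 0, 0, fun h => ?_⟩
  have := (orthonormal_hardyUnit hr).1 0
  rw [h, norm_zero] at this
  exact zero_ne_one this

/-- The Koopman operator is bounded, and even Hilbert-Schmidt, if the Fourier coefficients of the
powers of `τ` decay after rescaling. -/
theorem exists_koopmanOperator {τ : ℂ → ℂ} (hτ : IsAnalyticExpandingCircleMap τ) {r ρ κ : ℝ}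
    (hr_def : r = Real.exp (-ρ)) (hκ : 0 < κ)
    (hbound : ∀ k n : ℤ, ‖circleFourierCoeff (fun z => τ z ^ k) n‖ ≤
        Real.exp (-(ρ + κ) * |(k : ℝ)| + (ρ - κ) * |(n : ℝ)|)) :
    ∃ C : HardyCompl r →L[ℂ] HardyCompl r,
      IsKoopmanOperator τ C ∧ IsHilbertSchmidt C ∧
      ∀ k n : ℤ, hardyCoeff r n (C (hardyMonomial r k)) =
        circleFourierCoeff (fun z => τ z ^ k) n := by
  have hr : 0 < r := hr_def ▸ Real.exp_pos _
  set u : ℤ → ℝ := fun n => Real.exp (-κ * |(n : ℝ)|) with hu_def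
  have hu : Summable u := summable_exp_neg_mul_abs hκ
  have hU : 0 ≤ ∑' n, u n := tsum_nonneg fun n => (Real.exp_pos _).le
  -- The norm e^{-ρ|n|} of z^n turns the growth e^{(ρ-κ)|n|} into decay e^{-κ|n|}. Normalising z^k
  -- later does the same for the other index.
  have hterm : ∀ k n : ℤ, ‖circleFourierCoeff (fun z => τ z ^ k) n • hardyMonomial r n‖ ≤
      Real.exp (-(ρ + κ) * |(k : ℝ)|) * u n := by
    intro k n
    rw [norm_smul, norm_hardyMonomial hr, pow_natAbs_eq_exp hr_def]
    calc _ ≤ Real.exp (-(ρ + κ) * |(k : ℝ)| + (ρ - κ) * |(n : ℝ)|) *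
          Real.exp (-ρ * |(n : ℝ)|) := by gcongr; exact hbound k n
      _ = _ := by
          rw [← Real.exp_add, hu_def, ← Real.exp_add]; congr 1; ring
  have hsum : ∀ k : ℤ, Summable fun n : ℤ =>
      circleFourierCoeff (fun z => τ z ^ k) n • hardyMonomial r n := fun k =>
    Summable.of_norm_bounded (hu.mul_left _) (hterm k)
  let F : ℤ → HardyCompl r := fun k =>
    ∑' n : ℤ, circleFourierCoeff (fun z => τ z ^ k) n • hardyMonomial r n
  have hF : ∀ k, ‖F k‖ ≤ Real.exp (-(ρ + κ) * |(k : ℝ)|) * ∑' n, u n := fun k => by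
    rw [← tsum_mul_left]
    exact tsum_of_norm_bounded (hu.mul_left _).hasSum (hterm k)
  have hinv : ∀ k : ℤ, ((r ^ k.natAbs : ℝ) : ℂ) ≠ 0 := fun k => by
    exact_mod_cast (pow_pos hr _).ne'
  have hG : ∀ k, ‖((r ^ k.natAbs : ℝ) : ℂ)⁻¹ • F k‖ ≤ u k * ∑' n, u n := by
    intro k
    rw [norm_smul, norm_inv, Complex.norm_real, Real.norm_of_nonneg (by positivity),
      pow_natAbs_eq_exp hr_def, ← Real.exp_neg]
    calc _ ≤ Real.exp (-(-ρ * |(k : ℝ)|)) * (Real.exp (-(ρ + κ) * |(k : ℝ)|) * ∑' n, u n) := by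
          gcongr; exact hF k
      _ = _ := by
          rw [← mul_assoc, ← Real.exp_add]; congr 2; ring
  obtain ⟨C, hC⟩ := (hardyBasis hr).exists_clm_apply_eq
    (fun k => ((r ^ k.natAbs : ℝ) : ℂ)⁻¹ • F k)
    (Summable.of_nonneg_of_le (fun _ => norm_nonneg _) hG (hu.mul_right _))
  have hCm : ∀ k, C (hardyMonomial r k) = F k := by
    intro k
    rw [hardyMonomial_eq_smul hr, ← hardyBasis_apply hr, map_smul, hC, smul_smul,
      mul_inv_cancel₀ (hinv k), one_smul]
  refine ⟨C, fun p => ?_, (hardyBasis hr).isHilbertSchmidt C ?_, fun k n => ?_⟩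
  · have h1 : C (p : HardyCompl r) = ∑ k ∈ p.coeff.support, p.coeff k • F k := by
      rw [coe_eq_sum_hardyMonomial, map_sum]
      refine Finset.sum_congr rfl fun k _ => ?_
      rw [map_smul, hCm]
    have h2 : (fun n : ℤ => circleFourierCoeff (fun z => p.eval (τ z)) n • hardyMonomial r n) =
        fun n => ∑ k ∈ p.coeff.support, p.coeff k •
          (circleFourierCoeff (fun z => τ z ^ k) n • hardyMonomial r n) := by
      funext n
      have : (fun z => p.eval (τ z)) = fun z => ∑ k ∈ p.coeff.support, p.coeff k * τ z ^ k := rfl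
      rw [this, circleFourierCoeff_sum _ _ fun k _ => hτ.continuousOn_zpow k, Finset.sum_smul]
      refine Finset.sum_congr rfl fun k _ => ?_
      rw [smul_smul]
    rw [RepresentsFunction, h1, h2]
    exact hasSum_sum fun k _ => (hsum k).hasSum.const_smul _
  · refine Summable.of_nonneg_of_le (fun k => by positivity)
      (f := fun k => u k * (∑' n, u n) ^ 2) (fun k => ?_) (hu.mul_right _)
    rw [hC]
    have h1 : u k ≤ 1 := Real.exp_le_one_iff.mpr (by
      have := abs_nonneg (k : ℝ)
      nlinarith)
    have h0 : 0 ≤ u k := (Real.exp_pos _).le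
    calc _ ≤ (u k * ∑' n, u n) ^ 2 := by gcongr; exact hG k
      _ = u k * (u k * (∑' n, u n) ^ 2) := by ring
      _ ≤ u k * (1 * (∑' n, u n) ^ 2) := by gcongr
      _ = _ := by rw [one_mul]
  · rw [hCm]
    refine ((hsum k).hasSum.mapL (hardyCoeff r n)).tsum_eq.symm.trans ?_
    rw [tsum_eq_single n fun l hl => ?_]
    · rw [map_smul, hardyCoeff_hardyMonomial hr, if_pos rfl, smul_eq_mul, mul_one]
    · rw [map_smul, hardyCoeff_hardyMonomial hr, if_neg hl.symm, smul_zero]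

/-- After rescaling, the entries of the EDMD matrix agree with those of the Koopman operator up to
an exponentially small error. -/
theorem exists_edmdMatrix_sub_bound {τ : ℂ → ℂ} (hτ : IsAnalyticExpandingCircleMap τ)
    {δ ρ Γ : ℝ} (hρ : 0 < ρ) (hΓ0 : 0 < Γ) (hΓ : Γ + 1 < δ)
    (hbound : ∀ k n : ℤ, ‖circleFourierCoeff (fun z => τ z ^ k) n‖ ≤
        Real.exp (ρ * Γ * |(k : ℝ)| - ρ * |(n : ℝ)|)) :
    ∃ D θ : ℝ, 0 ≤ D ∧ 0 < θ ∧ ∀ (α : ℝ) (m n : ℕ), 0 < m → 2 * n ≤ m → δ * n ≤ m →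
      ∀ k l : LaurentIndex n,
        ‖edmdMatrix τ α m n k l - circleFourierCoeff (fun z => τ z ^ (k : ℤ)) l‖ *
          Real.exp (ρ * |((k : ℤ) : ℝ)| - ρ * |((l : ℤ) : ℝ)|) ≤ D * Real.exp (-θ * n) := by
  have hδ : 0 < δ := by linarith
  -- The share η of the decay e^{-ρ|q|} pays for the summation over q. The remainder, taken at |q| ≥
  -- m - |l|, still beats the growth in k, because (1 - η)δ = Γ + 1 + (δ - Γ - 1)/2.
  set η := (δ - Γ - 1) / (2 * δ) with hη
  have hη0 : 0 < η := div_pos (by linarith) (by linarith)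
  have hη1 : η < 1 := by rw [hη, div_lt_one (by linarith)]; linarith
  have hηδ : η * δ = (δ - Γ - 1) / 2 := by rw [hη]; field_simp
  set u : ℤ → ℝ := fun q => Real.exp (-(η * ρ) * |(q : ℝ)|) with hu_def
  have hu : Summable u := summable_exp_neg_mul_abs (by positivity)
  have hu0 : ∀ q, 0 ≤ u q := fun q => (Real.exp_pos _).le
  refine ⟨∑' q, u q, ρ * ((δ - Γ - 1) / 2), tsum_nonneg hu0, mul_pos hρ (by linarith), ?_⟩
  intro α m n hm hmn hδm k l
  have hs : Summable fun q => ‖circleFourierCoeff (fun z => τ z ^ (k : ℤ)) q‖ := by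
    refine Summable.of_nonneg_of_le (fun _ => norm_nonneg _) (hbound k) ?_
    refine ((summable_exp_neg_mul_abs hρ).mul_left (Real.exp (ρ * Γ * |((k : ℤ) : ℝ)|))).congr
      fun q => ?_
    rw [← Real.exp_add]; congr 1; ring
  have hk := Finset.mem_Ioo.mp k.2
  have hl := Finset.mem_Ioo.mp l.2
  have hk' : |((k : ℤ) : ℝ)| ≤ n := by
    have : |(k : ℤ)| ≤ n := (abs_lt.mpr hk).le
    exact_mod_cast this
  have halias := norm_equispaced_fourier_sub_le (hτ.continuousOn_zpow k) hs α hm l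
    (D := Real.exp (ρ * Γ * |((k : ℤ) : ℝ)| - (1 - η) * ρ * (m - |((l : ℤ) : ℝ)|)))
    (Real.exp_pos _).le hu hu0 (fun q hq => by
      refine (hbound k q).trans ?_
      rw [hu_def, ← Real.exp_add]
      apply Real.exp_le_exp.mpr
      have hq' : (m : ℝ) ≤ |(q : ℝ) - ((l : ℤ) : ℝ)| := by exact_mod_cast hq
      have hq2 : (m : ℝ) - |((l : ℤ) : ℝ)| ≤ |(q : ℝ)| := by
        linarith [abs_sub (q : ℝ) ((l : ℤ) : ℝ)]
      have h3 : 0 ≤ (1 - η) * ρ := mul_nonneg (by linarith) hρ.le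
      nlinarith [mul_le_mul_of_nonneg_left hq2 h3])
  rw [edmdMatrix_apply τ α hm hmn]
  calc _ ≤ (Real.exp (ρ * Γ * |((k : ℤ) : ℝ)| - (1 - η) * ρ * (m - |((l : ℤ) : ℝ)|)) *
        ∑' q, u q) * Real.exp (ρ * |((k : ℤ) : ℝ)| - ρ * |((l : ℤ) : ℝ)|) := by
        gcongr
    _ = (∑' q, u q) * Real.exp (ρ * ((Γ + 1) * |((k : ℤ) : ℝ)| - (1 - η) * m -
        η * |((l : ℤ) : ℝ)|)) := by
        rw [mul_comm (Real.exp _) (∑' q, u q), mul_assoc, ← Real.exp_add]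
        congr 2; ring
    _ ≤ _ := by
        refine mul_le_mul_of_nonneg_left (Real.exp_le_exp.mpr ?_) (tsum_nonneg hu0)
        have h1 : (Γ + 1) * |((k : ℤ) : ℝ)| ≤ (Γ + 1) * n := by gcongr
        have h2 : (1 - η) * (δ * n) ≤ (1 - η) * m :=
          mul_le_mul_of_nonneg_left hδm (by linarith)
        have h3 : 0 ≤ η * |((l : ℤ) : ℝ)| := by positivity
        have h4 : (1 - η) * (δ * n) = (δ - (δ - Γ - 1) / 2) * n := by rw [← hηδ]; ring
        have h5 : (Γ + 1) * |((k : ℤ) : ℝ)| - (1 - η) * m - η * |((l : ℤ) : ℝ)| ≤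
            -((δ - Γ - 1) / 2) * n := by linarith
        calc _ ≤ ρ * (-((δ - Γ - 1) / 2) * n) := mul_le_mul_of_nonneg_left h5 hρ.le
          _ = _ := by ring

/-- The finite rank operator on `H²(A_r^c)` given by (the transpose of) a matrix `M` indexed by
`|k| < n`. -/
def finiteSection (r : ℝ) {n : ℕ} (M : Matrix (LaurentIndex n) (LaurentIndex n) ℂ) :
    HardyCompl r →L[ℂ] HardyCompl r :=
  laurentEmbedding r n ∘L transposeOperator M ∘L laurentTruncation r n

/-- This is why the transpose appears: row k of M holds the coefficients of the image of z^k. -/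
theorem hardyCoeff_finiteSection {r : ℝ} (hr : 0 < r) {n : ℕ}
    (M : Matrix (LaurentIndex n) (LaurentIndex n) ℂ) (k l : LaurentIndex n) :
    hardyCoeff r l (finiteSection r M (hardyMonomial r k)) = M k l := by
  have h1 : laurentTruncation r n (hardyMonomial r k) = Pi.single k 1 := by
    funext i
    change hardyCoeff r i (hardyMonomial r k) = _
    rw [hardyCoeff_hardyMonomial hr, Pi.single_apply]
    simp only [Subtype.coe_inj]
  have h2 := congr_fun (congr($(laurentTruncation_comp_laurentEmbedding hr n)
    (transposeOperator M (Pi.single k 1)))) l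
  change hardyCoeff r l (laurentEmbedding r n (transposeOperator M
    (laurentTruncation r n (hardyMonomial r k)))) = _
  rw [h1]
  refine h2.trans ?_
  rw [ContinuousLinearMap.id_apply, transposeOperator_apply, Matrix.mulVec_single_one]
  rfl

theorem hardyCoeff_finiteSection_eq_zero {r : ℝ} (hr : 0 < r) {n : ℕ}
    (M : Matrix (LaurentIndex n) (LaurentIndex n) ℂ) {k l : ℤ}
    (h : ¬ (k ∈ Finset.Ioo (-(n : ℤ)) n ∧ l ∈ Finset.Ioo (-(n : ℤ)) n)) :
    hardyCoeff r l (finiteSection r M (hardyMonomial r k)) = 0 := by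
  change hardyCoeff r l (laurentEmbedding r n (transposeOperator M
    (laurentTruncation r n (hardyMonomial r k)))) = 0
  by_cases hk : k ∈ Finset.Ioo (-(n : ℤ)) n
  · have hl : l ∉ Finset.Ioo (-(n : ℤ)) n := fun hl => h ⟨hk, hl⟩
    rw [laurentEmbedding_apply, map_sum]
    refine Finset.sum_eq_zero fun i _ => ?_
    rw [map_smul, hardyCoeff_hardyMonomial hr, if_neg (fun hi : l = i => hl (hi ▸ i.2)), smul_zero]
  · have h1 : laurentTruncation r n (hardyMonomial r k) = 0 := by
      funext i
      change hardyCoeff r i (hardyMonomial r k) = 0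
      rw [hardyCoeff_hardyMonomial hr, if_neg (fun hi : (i : ℤ) = k => hk (hi ▸ i.2))]
    rw [h1, map_zero, map_zero, map_zero]

/-- The finite sections built from the EDMD matrices converge to the Koopman operator at an
exponential rate. -/
theorem exists_norm_finiteSection_sub_le {τ : ℂ → ℂ} {r ρ κ θ D : ℝ}
    (hr_def : r = Real.exp (-ρ)) (hκ : 0 < κ) (hθ : 0 < θ)
    (hD : 0 ≤ D)
    (hbound : ∀ k n : ℤ, ‖circleFourierCoeff (fun z => τ z ^ k) n‖ ≤
        Real.exp (-(ρ + κ) * |(k : ℝ)| + (ρ - κ) * |(n : ℝ)|))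
    {C : HardyCompl r →L[ℂ] HardyCompl r}
    (hC : ∀ k n : ℤ, hardyCoeff r n (C (hardyMonomial r k)) =
        circleFourierCoeff (fun z => τ z ^ k) n) :
    ∃ K a : ℝ, 0 < a ∧ ∀ (n : ℕ) (M : Matrix (LaurentIndex n) (LaurentIndex n) ℂ),
      (∀ k l : LaurentIndex n, ‖M k l - circleFourierCoeff (fun z => τ z ^ (k : ℤ)) l‖ *
          Real.exp (ρ * |((k : ℤ) : ℝ)| - ρ * |((l : ℤ) : ℝ)|) ≤ D * Real.exp (-θ * n)) →
      ‖finiteSection r M - C‖ ≤ K * Real.exp (-a * n) := by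
  have hr : 0 < r := hr_def ▸ Real.exp_pos _
  -- Inside the block, θn must dominate c(n + |k| + |l|) ≤ 3cn. Outside it |k| + |l| ≥ n, so κ(|k| +
  -- |l|) ≥ 2c(|k| + |l|) dominates the same quantity.
  set c := min (κ / 2) (θ / 4) with hc_def
  have hc : 0 < c := lt_min (by linarith) (by linarith)
  have hcκ : c ≤ κ / 2 := min_le_left _ _
  have hcθ : c ≤ θ / 4 := min_le_right _ _
  set u : ℤ → ℝ := fun q => Real.exp (-c * |(q : ℝ)|) with hu_def
  have hu : Summable u := summable_exp_neg_mul_abs hc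
  have hu0 : ∀ q, 0 ≤ u q := fun q => (Real.exp_pos _).le
  refine ⟨(1 + D) * (∑' q, u q) ^ 2, c, hc, fun n M hM => ?_⟩
  have hent : ∀ l k : ℤ, ‖inner ℂ (hardyBasis hr l) ((finiteSection r M - C) (hardyBasis hr k))‖ ≤
      (1 + D) * Real.exp (-c * n) * u k * u l := by
    intro l k
    have h1 : ‖inner ℂ (hardyBasis hr l) ((finiteSection r M - C) (hardyBasis hr k))‖ =
        ‖hardyCoeff r l (finiteSection r M (hardyMonomial r k)) -
          circleFourierCoeff (fun z => τ z ^ k) l‖ *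
          Real.exp (ρ * |(k : ℝ)| - ρ * |(l : ℝ)|) := by
      rw [hardyBasis_apply, hardyBasis_apply, inner_hardyUnit hr, ← hC k l, ← map_sub,
        ← _root_.sub_apply, hardyUnit.eq_def r k, map_smul, map_smul, norm_mul, norm_smul,
        norm_inv, Complex.norm_real, Complex.norm_real, Real.norm_of_nonneg (by positivity),
        Real.norm_of_nonneg (by positivity), pow_natAbs_eq_exp hr_def,
        pow_natAbs_eq_exp hr_def,
        ← Real.exp_neg, mul_left_comm, ← mul_assoc, ← Real.exp_add, mul_comm]
      congr 2
      ring
    rw [h1]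
    have habs := abs_nonneg (k : ℝ)
    have habs' := abs_nonneg (l : ℝ)
    have hprod : Real.exp (-c * n) * u k * u l =
        Real.exp (-c * n - c * |(k : ℝ)| - c * |(l : ℝ)|) := by
      rw [hu_def, ← Real.exp_add, ← Real.exp_add]; congr 1; ring
    have hassoc : (1 + D) * Real.exp (-c * n) * u k * u l =
        (1 + D) * Real.exp (-c * n - c * |(k : ℝ)| - c * |(l : ℝ)|) := by
      rw [← hprod]; ring
    rw [hassoc]
    by_cases hkl : k ∈ Finset.Ioo (-(n : ℤ)) n ∧ l ∈ Finset.Ioo (-(n : ℤ)) n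
    · have h2 := hM ⟨k, hkl.1⟩ ⟨l, hkl.2⟩
      have h3 := hardyCoeff_finiteSection hr M ⟨k, hkl.1⟩ ⟨l, hkl.2⟩
      simp only at h2 h3
      rw [h3]
      refine h2.trans ?_
      have hk : |(k : ℝ)| ≤ n := by
        have : |k| ≤ n := (abs_lt.mpr (Finset.mem_Ioo.mp hkl.1)).le
        exact_mod_cast this
      have hl : |(l : ℝ)| ≤ n := by
        have : |l| ≤ n := (abs_lt.mpr (Finset.mem_Ioo.mp hkl.2)).le
        exact_mod_cast this
      refine mul_le_mul (by linarith) (Real.exp_le_exp.mpr ?_) (Real.exp_pos _).le (by linarith)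
      nlinarith
    · rw [hardyCoeff_finiteSection_eq_zero hr M hkl, zero_sub, norm_neg]
      have h2 : (n : ℝ) ≤ |(k : ℝ)| + |(l : ℝ)| := by
        rw [Finset.mem_Ioo, Finset.mem_Ioo, ← abs_lt, ← abs_lt] at hkl
        have : (n : ℤ) ≤ |k| + |l| := by
          have := abs_nonneg k
          have := abs_nonneg l
          omega
        exact_mod_cast this
      calc _ ≤ Real.exp (-(ρ + κ) * |(k : ℝ)| + (ρ - κ) * |(l : ℝ)|) *
            Real.exp (ρ * |(k : ℝ)| - ρ * |(l : ℝ)|) := by gcongr; exact hbound k l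
        _ = Real.exp (-κ * (|(k : ℝ)| + |(l : ℝ)|)) := by
            rw [← Real.exp_add]; congr 1; ring
        _ ≤ 1 * Real.exp (-c * n - c * |(k : ℝ)| - c * |(l : ℝ)|) := by
            rw [one_mul]
            apply Real.exp_le_exp.mpr
            nlinarith
        _ ≤ _ := by gcongr; linarith
  refine ((hardyBasis hr).opNorm_le_of_norm_inner_le _ hu hu0 (by positivity) hent).trans
    (le_of_eq (by ring))

end
noncomputable section

/-! ### Spectra of finite sections and of EDMD matrices -/

section FiniteSection

variable {r : ℝ} {n : ℕ} {M : Matrix (LaurentIndex n) (LaurentIndex n) ℂ}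

theorem mem_spectrum_finiteSection (hr : 0 < r) {lam : ℂ} (h : lam ∈ spectrum ℂ M) :
    lam ∈ spectrum ℂ (finiteSection r M) := by
  have h1 : lam ∈ spectrum ℂ (Matrix.toLin' M.transpose) := by
    rw [Matrix.spectrum_toLin', Matrix.mem_spectrum_iff_isRoot_charpoly,
      Matrix.charpoly_transpose, ← Matrix.mem_spectrum_iff_isRoot_charpoly]
    exact h
  obtain ⟨v, hv⟩ := (Module.End.hasEigenvalue_iff_mem_spectrum.mpr h1).exists_hasEigenvector
  exact mem_spectrum_comp_of_apply_eq_smul (laurentTruncation_comp_laurentEmbedding hr n) hv.2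
    hv.apply_eq_smul

/-- The value 0 must be excluded: a finite section kills every z^k with |k| ≥ n, so 0 is in its
spectrum whatever M is. -/
theorem mem_spectrum_of_mem_spectrum_finiteSection (hr : 0 < r) {lam : ℂ} (hlam : lam ≠ 0)
    (h : lam ∈ spectrum ℂ (finiteSection r M)) : lam ∈ spectrum ℂ M := by
  rw [← spectrum_transposeOperator]
  exact mem_spectrum_of_mem_spectrum_comp (laurentTruncation_comp_laurentEmbedding hr n) hlam h

theorem finiteSection_laurentEmbedding (hr : 0 < r) (v : LaurentIndex n → ℂ) :
    finiteSection r M (laurentEmbedding r n v) =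
      laurentEmbedding r n (Matrix.toLin' M.transpose v) := by
  have h : laurentTruncation r n (laurentEmbedding r n v) = v :=
    congr($(laurentTruncation_comp_laurentEmbedding hr n) v)
  change laurentEmbedding r n (transposeOperator M
    (laurentTruncation r n (laurentEmbedding r n v))) = _
  rw [h]
  rfl

/-- The embedding intertwines the transpose of M with the finite section, hence also all powers
after subtracting λ. -/
theorem exists_pow_finiteSection_sub_apply_eq_zero (hr : 0 < r) {lam : ℂ} {ξ : LaurentIndex n → ℂ}
    (hξ : ξ ∈ Module.End.maxGenEigenspace (Matrix.toLin' M.transpose) lam) :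
    ∃ N : ℕ, ((finiteSection r M - lam • 1) ^ N) (laurentVector r ξ) = 0 := by
  obtain ⟨N, hN⟩ := (Module.End.mem_maxGenEigenspace _ _ _).mp hξ
  refine ⟨N, ?_⟩
  have key : ∀ (j : ℕ) (v : LaurentIndex n → ℂ),
      ((finiteSection r M - lam • 1) ^ j) (laurentEmbedding r n v) =
        laurentEmbedding r n (((Matrix.toLin' M.transpose - lam • 1) ^ j) v) := by
    intro j
    induction j with
    | zero => intro v; rfl
    | succ j ih =>
      intro v
      have h1 : (finiteSection r M - lam • 1) (laurentEmbedding r n v) =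
          laurentEmbedding r n ((Matrix.toLin' M.transpose - lam • 1) v) := by
        change finiteSection r M (laurentEmbedding r n v) - lam • laurentEmbedding r n v =
          laurentEmbedding r n (Matrix.toLin' M.transpose v - lam • v)
        rw [finiteSection_laurentEmbedding hr, map_sub, map_smul]
      rw [pow_succ, pow_succ]
      change ((finiteSection r M - lam • 1) ^ j) ((finiteSection r M - lam • 1) _) = _
      rw [h1, ih]
      rfl
  rw [← laurentEmbedding_eq_laurentVector, key, hN, map_zero]

/-- The finite section is the finite rank part of C, and the remainder has norm below ‖μ‖. -/
theorem hasEigenvalue_and_pole_of_norm_finiteSection_sub_lt (hr : 0 < r)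
    {C : HardyCompl r →L[ℂ] HardyCompl r} {μ : ℂ} (h : ‖finiteSection r M - C‖ < ‖μ‖)
    (hμ : μ ∈ spectrum ℂ C) :
    Module.End.HasEigenvalue (C : HardyCompl r →ₗ[ℂ] HardyCompl r) μ ∧
    ∃ (K ε : ℝ) (p : ℕ), 0 < ε ∧ ∀ ζ : ℂ, 0 < ‖ζ - μ‖ → ‖ζ - μ‖ ≤ ε →
      ζ ∈ resolventSet ℂ C ∧ ‖resolvent C ζ‖ * ‖ζ - μ‖ ^ p ≤ K := by
  have := nontrivial_hardyCompl hr
  have hsum : (C - finiteSection r M) +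
      (laurentEmbedding r n ∘L transposeOperator M) ∘L laurentTruncation r n = C :=
    sub_add_cancel _ _
  have key := hasEigenvalue_and_pole_of_finite_rank (C - finiteSection r M)
    (laurentEmbedding r n ∘L transposeOperator M) (laurentTruncation r n) (μ := μ)
    (by rwa [norm_sub_rev]) (by rwa [hsum])
  rwa [hsum] at key

end FiniteSection

/-- A choice of points in given sets which realises an eventual exponential rate. -/
theorem exists_seq_of_eventually_exists {A : ℕ → Set ℂ} (hA : ∀ n, 1 ≤ n → (A n).Nonempty) {μ : ℂ}
    {D a : ℝ} (ha : 0 < a)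
    (h : ∀ᶠ n : ℕ in atTop, ∃ lam ∈ A n, ‖lam - μ‖ ≤ D * Real.exp (-a * n)) :
    ∃ lam : ℕ → ℂ, (∀ n, 1 ≤ n → lam n ∈ A n) ∧ Tendsto lam atTop (𝓝 μ) ∧
      ∃ a : ℝ, 0 < a ∧ (fun n : ℕ => ‖μ - lam n‖) =O[atTop] fun n : ℕ => Real.exp (-a * n) := by
  have hex : ∀ n : ℕ, ∃ x : ℂ, (1 ≤ n → x ∈ A n) ∧
      ((∃ y ∈ A n, ‖y - μ‖ ≤ D * Real.exp (-a * n)) → ‖x - μ‖ ≤ D * Real.exp (-a * n)) := by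
    intro n
    by_cases hn : ∃ y ∈ A n, ‖y - μ‖ ≤ D * Real.exp (-a * n)
    · obtain ⟨y, hy, hy'⟩ := hn
      exact ⟨y, fun _ => hy, fun _ => hy'⟩
    · by_cases h1 : 1 ≤ n
      · obtain ⟨x, hx⟩ := hA n h1
        exact ⟨x, fun _ => hx, fun h => absurd h hn⟩
      · exact ⟨0, fun h => absurd h h1, fun h => absurd h hn⟩
  choose lam h1 h2 using hex
  have h3 : ∀ᶠ n : ℕ in atTop, ‖lam n - μ‖ ≤ D * Real.exp (-a * n) := h.mono fun n hn => h2 n hn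
  have hlim : Tendsto (fun n : ℕ => D * Real.exp (-a * n)) atTop (𝓝 0) := by
    simpa using (Real.tendsto_exp_atBot.comp
      (tendsto_natCast_atTop_atTop.const_mul_atTop_of_neg (neg_lt_zero.mpr ha))).const_mul D
  refine ⟨lam, h1, tendsto_iff_norm_sub_tendsto_zero.mpr ?_, a, ha, ?_⟩
  · exact squeeze_zero' (Eventually.of_forall fun _ => norm_nonneg _) h3 hlim
  · refine Asymptotics.IsBigO.of_bound D (h3.mono fun n hn => ?_)
    rw [norm_norm, norm_sub_rev, Real.norm_of_nonneg (Real.exp_pos _).le]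
    exact hn

/-- Matrices which are close to the sections of the Koopman operator have an exponentially small
eigenvalue. -/
theorem exists_small_mem_spectrum_of_sub_bound {τ : ℂ → ℂ} {ρ κ θ D : ℝ} (hκ : 0 < κ)
    (hθ : 0 < θ) (hD : 0 ≤ D)
    (hbound : ∀ k n : ℤ, ‖circleFourierCoeff (fun z => τ z ^ k) n‖ ≤
        Real.exp (-(ρ + κ) * |(k : ℝ)| + (ρ - κ) * |(n : ℝ)|)) :
    ∃ K a : ℝ, 0 < a ∧ ∀ (n : ℕ) (M : Matrix (LaurentIndex n) (LaurentIndex n) ℂ), 1 ≤ n →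
      (∀ k l : LaurentIndex n, ‖M k l - circleFourierCoeff (fun z => τ z ^ (k : ℤ)) l‖ *
          Real.exp (ρ * |((k : ℤ) : ℝ)| - ρ * |((l : ℤ) : ℝ)|) ≤ D * Real.exp (-θ * n)) →
      ∃ lam ∈ spectrum ℂ M, ‖lam - 0‖ ≤ K * Real.exp (-a * n) := by
  -- Since |l| ≤ n, the error e^{-θn} is also at most e^{-c|l|}, so the rescaled entries of M decay
  -- in l at rate c.
  set c := min θ κ with hc_def
  have hc : 0 < c := lt_min hθ hκ
  refine ⟨2 * (4 / c) * (1 + D) * Real.exp (c / 2), c / 4, by positivity, fun n M hn hM => ?_⟩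
  obtain ⟨lam, hlam, hle⟩ := exists_small_mem_spectrum hn M
    (w := fun k => Real.exp (-ρ * |((k : ℤ) : ℝ)|)) (fun k => Real.exp_pos _)
    (K := 1 + D) (c := c) (by linarith) hc.le (fun k l => by
      have hl : |((l : ℤ) : ℝ)| ≤ n := by
        have : |(l : ℤ)| ≤ n := (abs_lt.mpr (Finset.mem_Ioo.mp l.2)).le
        exact_mod_cast this
      have hk0 := abs_nonneg ((k : ℤ) : ℝ)
      have hl0 := abs_nonneg ((l : ℤ) : ℝ)
      set x := |((k : ℤ) : ℝ)|
      set y := |((l : ℤ) : ℝ)|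
      set b := circleFourierCoeff (fun z => τ z ^ (k : ℤ)) l with hb
      have h1 : ‖b‖ * Real.exp (ρ * x - ρ * y) ≤ Real.exp (-c * y) := by
        calc _ ≤ Real.exp (-(ρ + κ) * x + (ρ - κ) * y) * Real.exp (ρ * x - ρ * y) := by
              gcongr; exact hbound k l
          _ = Real.exp (-κ * x - κ * y) := by rw [← Real.exp_add]; congr 1; ring
          _ ≤ _ := by
              apply Real.exp_le_exp.mpr
              nlinarith [min_le_right θ κ]
      have h2 : ‖M k l - b‖ * Real.exp (ρ * x - ρ * y) ≤ D * Real.exp (-c * y) := by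
        refine (hM k l).trans (mul_le_mul_of_nonneg_left (Real.exp_le_exp.mpr ?_) hD)
        nlinarith [min_le_left θ κ]
      have h3 : ‖M k l‖ ≤ ‖b‖ + ‖M k l - b‖ := by
        simpa using norm_add_le b (M k l - b)
      have h4 : ‖M k l‖ * Real.exp (ρ * x - ρ * y) ≤ (1 + D) * Real.exp (-c * y) := by
        calc _ ≤ (‖b‖ + ‖M k l - b‖) * Real.exp (ρ * x - ρ * y) := by gcongr
          _ ≤ _ := by rw [add_mul]; linarith
      calc ‖M k l‖ * Real.exp (-ρ * y) =
            (‖M k l‖ * Real.exp (ρ * x - ρ * y)) * Real.exp (-ρ * x) := by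
            rw [mul_assoc, ← Real.exp_add]; congr 2; ring
        _ ≤ ((1 + D) * Real.exp (-c * y)) * Real.exp (-ρ * x) := by gcongr
        _ = _ := by ring)
  refine ⟨lam, hlam, ?_⟩
  rw [sub_zero]
  refine hle.trans ?_
  -- The linear factor n is absorbed by lowering the rate from c/2 to c/4.
  have hn' : (n : ℝ) ≤ 4 / c * Real.exp (c / 4 * n) := by
    have := Real.add_one_le_exp (c / 4 * n)
    rw [div_mul_eq_mul_div, le_div_iff₀ hc]
    linarith
  calc 2 * n * (1 + D) * Real.exp (-(c / 2) * (n - 1))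
      ≤ 2 * (4 / c * Real.exp (c / 4 * n)) * (1 + D) * Real.exp (-(c / 2) * (n - 1)) := by gcongr
    _ = 2 * (4 / c) * (1 + D) * (Real.exp (c / 4 * n) * Real.exp (-(c / 2) * (n - 1))) := by ring
    _ = _ := by
        rw [mul_assoc _ (Real.exp (c / 2)), ← Real.exp_add, ← Real.exp_add]
        congr 2; ring

end

/-! ### The convergence theorem -/

theorem theorem2p9 (τ : ℂ → ℂ) (hτ : IsAnalyticExpandingCircleMap τ)
    (δ : ℝ) (hδ : 1 + maxDeriv τ < δ) :
    ∃ r : ℝ, 0 < r ∧ r < 1 ∧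
      ∃ C : HardyCompl r →L[ℂ] HardyCompl r, IsKoopmanOperator τ C ∧ IsHilbertSchmidt C ∧
        ∀ (α : ℝ) (m : ℕ → ℕ), (∀ n : ℕ, 1 ≤ n → δ * n ≤ m n) →
          -- limits of EDMD eigenvalues are spectral points
          (∀ (lam : ℕ → ℂ) (μ : ℂ),
            (∀ n, 1 ≤ n → lam n ∈ spectrum ℂ (edmdMatrix τ α (m n) n)) →
            Tendsto lam atTop (𝓝 μ) → μ ∈ spectrum ℂ C) ∧
          -- every spectral point is approximated at an exponential rate
          (∀ μ ∈ spectrum ℂ C, ∃ lam : ℕ → ℂ,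
            (∀ n, 1 ≤ n → lam n ∈ spectrum ℂ (edmdMatrix τ α (m n) n)) ∧
            Tendsto lam atTop (𝓝 μ) ∧
            ∃ a : ℝ, 0 < a ∧
              (fun n : ℕ => ‖μ - lam n‖) =O[atTop] fun n : ℕ => Real.exp (-a * n)) ∧
          -- approximation of generalised eigenvectors at an exponential rate
          (∀ μ ∈ spectrum ℂ C, μ ≠ 0 →
            Module.End.HasEigenvalue (C : HardyCompl r →ₗ[ℂ] HardyCompl r) μ ∧
            ∃ P : HardyCompl r →L[ℂ] HardyCompl r, IsSpectralProjection C μ P ∧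
              ∃ b : ℝ, 0 < b ∧
                ∀ (lam : ℕ → ℂ) (ξ : ∀ n : ℕ, LaurentIndex n → ℂ),
                  (∀ n, 1 ≤ n → lam n ∈ spectrum ℂ (edmdMatrix τ α (m n) n)) →
                  Tendsto lam atTop (𝓝 μ) →
                  (∀ n, 1 ≤ n → ξ n ∈ Module.End.maxGenEigenspace
                    (Matrix.toLin' (edmdMatrix τ α (m n) n).transpose) (lam n)) →
                  (∀ n, 1 ≤ n →
                    ∑ k, ‖ξ n k‖ ^ 2 * r ^ (2 * (k : ℤ).natAbs) = 1) →
                  (fun n : ℕ => ‖P (laurentVector r (ξ n)) - laurentVector r (ξ n)‖)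
                    =O[atTop] fun n : ℕ => Real.exp (-b * n)) := by
  obtain ⟨ρ, Γ, κ, hρ, hΓ1, hΓ, hκ, hB1, hB2⟩ := hτ.exists_fourier_bounds hδ
  -- The radius and the constants of the next four estimates are fixed before α and m are given.
  obtain ⟨r, hr_def⟩ : ∃ r, r = Real.exp (-ρ) := ⟨_, rfl⟩
  have hr : 0 < r := hr_def ▸ Real.exp_pos _
  obtain ⟨C, hCK, hCHS, hC⟩ := exists_koopmanOperator hτ hr_def hκ hB2
  obtain ⟨D, θ, hD, hθ, halias⟩ := exists_edmdMatrix_sub_bound hτ hρ (by linarith) hΓ hB1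
  obtain ⟨K, a, ha, hconv⟩ := exists_norm_finiteSection_sub_le hr_def hκ hθ hD hB2 hC
  obtain ⟨K₀, a₀, ha₀, hsmall⟩ := exists_small_mem_spectrum_of_sub_bound hκ hθ hD hB2
  refine ⟨r, hr, by rw [hr_def]; simpa using hρ, C, hCK, hCHS,
    fun α m hm => ?_⟩
  have hent : ∀ n, 1 ≤ n → ∀ k l : LaurentIndex n,
      ‖edmdMatrix τ α (m n) n k l - circleFourierCoeff (fun z => τ z ^ (k : ℤ)) l‖ *
        Real.exp (ρ * |((k : ℤ) : ℝ)| - ρ * |((l : ℤ) : ℝ)|) ≤ D * Real.exp (-θ * n) := by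
    intro n hn
    have hn' : (1 : ℝ) ≤ n := by exact_mod_cast hn
    -- Expansion gives Γ > 1, hence δ > Γ + 1 > 2.
    have h2 : (2 * n : ℝ) ≤ m n := by nlinarith [hm n hn]
    have h2' : 2 * n ≤ m n := by exact_mod_cast h2
    exact halias α (m n) n (by omega) h2' (hm n hn)
  have hS : ∀ n, 1 ≤ n →
      ‖finiteSection r (edmdMatrix τ α (m n) n) - C‖ ≤ K * Real.exp (-a * n) :=
    fun n hn => hconv n _ (hent n hn)
  have hSev : ∀ᶠ n : ℕ in atTop,
      ‖finiteSection r (edmdMatrix τ α (m n) n) - C‖ ≤ K * Real.exp (-a * n) :=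
    (eventually_ge_atTop 1).mono hS
  have hlim : Tendsto (fun n : ℕ => ‖finiteSection r (edmdMatrix τ α (m n) n) - C‖) atTop (𝓝 0) := by
    refine squeeze_zero' (Eventually.of_forall fun _ => norm_nonneg _) hSev ?_
    simpa using (Real.tendsto_exp_atBot.comp
      (tendsto_natCast_atTop_atTop.const_mul_atTop_of_neg (neg_lt_zero.mpr ha))).const_mul K
  have hpole : ∀ μ ∈ spectrum ℂ C, μ ≠ 0 →
      Module.End.HasEigenvalue (C : HardyCompl r →ₗ[ℂ] HardyCompl r) μ ∧
      ∃ (K ε : ℝ) (p : ℕ), 0 < ε ∧ ∀ ζ : ℂ, 0 < ‖ζ - μ‖ → ‖ζ - μ‖ ≤ ε →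
        ζ ∈ resolventSet ℂ C ∧ ‖resolvent C ζ‖ * ‖ζ - μ‖ ^ p ≤ K := by
    intro μ hμ hμ0
    obtain ⟨n, hn⟩ := (hlim.eventually (gt_mem_nhds (norm_pos_iff.mpr hμ0))).exists
    exact hasEigenvalue_and_pole_of_norm_finiteSection_sub_lt hr hn hμ
  refine ⟨fun lam μ hlam hμ => ?_, fun μ hμ => ?_, fun μ hμ hμ0 => ?_⟩
  · refine mem_spectrum_of_tendsto (tendsto_iff_norm_sub_tendsto_zero.mpr hlim) hμ ?_
    exact (eventually_ge_atTop 1).mono fun n hn => mem_spectrum_finiteSection hr (hlam n hn)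
  · have hA : ∀ n, 1 ≤ n → (spectrum ℂ (edmdMatrix τ α (m n) n)).Nonempty := fun n hn => by
      obtain ⟨x, hx, -⟩ := hsmall n _ hn (hent n hn)
      exact ⟨x, hx⟩
    -- At μ = 0 the finite sections say nothing about M, and the determinant bound is used instead.
    rcases eq_or_ne μ 0 with rfl | hμ0
    · exact exists_seq_of_eventually_exists hA ha₀
        ((eventually_ge_atTop 1).mono fun n hn => hsmall n _ hn (hent n hn))
    · obtain ⟨-, K', ε, p, hε, hres⟩ := hpole μ hμ hμ0
      obtain ⟨a', ha', hnear⟩ := exists_mem_spectrum_near_pole hμ hε hres ha hSev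
      have hexp : Tendsto (fun n : ℕ => Real.exp (-a' * n)) atTop (𝓝 0) :=
        Real.tendsto_exp_atBot.comp
          (tendsto_natCast_atTop_atTop.const_mul_atTop_of_neg (neg_lt_zero.mpr ha'))
      refine exists_seq_of_eventually_exists hA ha' (D := 1) ?_
      -- For large n the disc about μ excludes 0, so the spectral point found in it is an eigenvalue
      -- of the matrix itself.
      filter_upwards [hnear, hexp.eventually (gt_mem_nhds (norm_pos_iff.mpr hμ0))] with n hn hn'
      obtain ⟨x, hx, hxμ⟩ := hn
      refine ⟨x, mem_spectrum_of_mem_spectrum_finiteSection hr ?_ hx, by rwa [one_mul]⟩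
      rintro rfl
      rw [zero_sub, norm_neg] at hxμ
      exact absurd hn' (not_lt.mpr hxμ)
  · obtain ⟨heig, K', ε, p, hε, hres⟩ := hpole μ hμ hμ0
    have hsphere : ∀ ζ ∈ Metric.sphere μ ε, ζ ∈ resolventSet ℂ C := fun ζ hζ => by
      rw [mem_sphere_iff_norm] at hζ
      exact (hres ζ (by rw [hζ]; exact hε) hζ.le).1
    -- The contour is the circle on which the pole bound holds, and b = a is the rate of convergence
    -- in operator norm.
    refine ⟨heig, (2 * Real.pi * Complex.I : ℂ)⁻¹ • ∮ ζ in C(μ, ε), resolvent C ζ,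
      ⟨ε, hε, ?_, rfl⟩, a, ha, fun lam ξ _ hlamμ hξ hnorm => ?_⟩
    · ext ζ
      constructor
      · rintro ⟨h1, h2⟩
        by_contra hne
        rw [mem_closedBall_iff_norm] at h1
        exact h2 (hres ζ (norm_pos_iff.mpr (sub_ne_zero.mpr hne)) h1).1
      · rintro rfl
        exact ⟨Metric.mem_closedBall_self hε.le, hμ⟩
    obtain ⟨K₁, η, hη, hproj⟩ := exists_norm_circleIntegral_resolvent_apply_sub_le hε hsphere
    refine Asymptotics.IsBigO.of_bound (|K₁| * K) ?_
    filter_upwards [eventually_ge_atTop 1, hlim.eventually (gt_mem_nhds hη),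
      hlamμ.eventually (Metric.ball_mem_nhds μ hε)] with n hn h1 h2
    obtain ⟨N, hN⟩ := exists_pow_finiteSection_sub_apply_eq_zero hr (hξ n hn)
    have h3 := hproj _ h1.le (lam n) h2 (finiteSection r (edmdMatrix τ α (m n) n) - lam n • 1)
      (fun x => rfl) N _ hN
    have h4 : ‖laurentVector r (ξ n)‖ = 1 := by
      rw [← pow_left_inj₀ (norm_nonneg _) zero_le_one two_ne_zero, norm_laurentVector_sq hr,
        hnorm n hn, one_pow]
    rw [norm_norm, Real.norm_of_nonneg (Real.exp_pos _).le]
    calc _ ≤ K₁ * ‖finiteSection r (edmdMatrix τ α (m n) n) - C‖ * ‖laurentVector r (ξ n)‖ := h3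
      _ ≤ |K₁| * (K * Real.exp (-a * n)) := by
          rw [h4, mul_one]
          gcongr
          · exact le_abs_self _
          · exact hS n hn
      _ = _ := by ring
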